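/- Consider the inverted pendulum on a cart with constants $M,m,l,J,\kappa,g,G>0$ and $c_0\in\mathbb R$ ($M,m$: masses of cart and pendulum; $l$: length of the pendulum; $J$: its moment of inertia about its centre of mass; $\kappa,c_0$: friction coefficients of the pendulum; $g$: gravity; $G$: amplification of the motor) and regulator constants $\rho,a,\alpha>0$. Put $$L=ml,\quad I=J+ml^2,\quad c=c_0+\kappa l,\quad A=|G(I-\rho L)|,\quad B=\frac AG,$$ $$d_1=\frac{\kappa\rho-c}{\rho L-I},\quad d_2=\frac{Lg}{\rho L-I},\quad d_3=\frac{I}{\rho L-I},\quad \psi(\beta)=MI-L^2\cos^2\beta .$$ Assume $MI>L^2$ (so that $\psi>0$ everywhere), $\rho L>I$ (equivalently, $q=2\rho L/(\rho L-I)>1$), and $d_1>0$. In the variables $(s,\gamma,\Omega,\dot\Omega)\in\mathbb R^4$, where $\Omega=-\ln|\tan(\frac\pi4-\frac\beta2)|$, that is $\beta=\beta(\Omega)=2(\frac\pi4-\arctan e^{-\Omega})\in(-\frac\pi2,\frac\pi2)$ is the angle of the pendulum, $s=r+\rho\,\Omega$ with $r$ the position of the cart, and $\gamma=\psi(\beta)(\dot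 s+\alpha s)$, the motion is governed by $$\dot s=\frac{\gamma}{\psi(\beta)}-\alpha s,\qquad \dot\gamma=-a\gamma-A\,\Delta u-B\,D(t),\qquad \frac{d\Omega}{dt}=\dot\Omega,$$ $$\frac{d\dot\Omega}{dt}=-d_1\dot\Omega-d_2\tan\beta-d_3\dot\Omega^2\sin\beta+\frac{L}{\rho L-I}\cdot\frac{(-a\gamma-A\,\Delta u-B\,D(t))\,\psi-\gamma\,\dot\psi}{\psi^2}+\sigma\Bigl(\frac{\gamma}{\psi(\beta)}-\alpha s\Bigr),$$ where $\dot\psi=L^2\sin(2\beta)\,\dot\Omega\cos\beta$ is the time derivative of $\psi(\beta)$ and $\sigma\in\mathbb R$ is a constant (the mechanical model has $\sigma=(\kappa-\alpha L)/(\rho L-I)$, but $\sigma$ may be any real number). The unknown disturbance $D$ is continuous on $[0,\infty)$ with $|D(t)|\le\Pi$ for all $t\ge 0$, and the control is the discontinuous relay $\Delta u=\bar\Pi\,\operatorname{sign}\gamma$, where $\operatorname{sign}\gamma=\pm1$ for $\pm\gamma>0$ and $\operatorname{sign}0=[-1,1]$, with $\bar\Pi\ge\Pi/G$. Solutions are understood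 in the sense of Gelig–Leonov–Yakubovich: a solution on an interval is a function $x=(s,\gamma,\Omega,\dot\Omega)$ that is absolutely continuous on compact subintervals and satisfies, for almost every $t$, the equations with some value $\xi=\xi(t)\in\operatorname{sign}\gamma(t)$, the same in all the equations, in place of $\operatorname{sign}\gamma$. Then the system is globally asymptotically stable, that is: (i) for every $t_0\ge 0$ and $x_0\in\mathbb R^4$ there is a solution $x$ on $[t_0,\infty)$ with $x(t_0)=x_0$; (ii) every solution on an interval $[t_0,T)$ with $0\le t_0<T<\infty$ extends to a solution on $[t_0,\infty)$; (iii) for every $\varepsilon>0$ there is $\delta>0$ such that for every $t_0\ge 0$ every solution $x$ on $[t_0,\infty)$ with $|x(t_0)|<\delta$ satisfies $|x(t)|<\varepsilon$ for all $t\ge t_0$; (iv) every solution on $[t_0,\infty)$ with $t_0\ge0$ satisfies $x(t)\to 0$ as $t\to\infty$. -/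

import Mathlib

open Set Filter Topology MeasureTheory

/-- `x` is a solution of the differential inclusion `x'(t) ∈ F t (x t)` on the interval `I`:
it is absolutely continuous on every compact subinterval of `I`, and the inclusion holds
for almost every `t ∈ I`. -/
def IsSolutionOn {E : Type*} [NormedAddCommGroup E] [NormedSpace ℝ E]
    (F : ℝ → E → Set E) (x : ℝ → E) (I : Set ℝ) : Prop :=
  (∀ t₁ t₂ : ℝ, t₁ ≤ t₂ → Icc t₁ t₂ ⊆ I → AbsolutelyContinuousOnInterval x t₁ t₂) ∧
    ∀ᵐ t : ℝ ∂volume, t ∈ I → ∃ v ∈ F t (x t), HasDerivAt x v t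

/-- Global asymptotic stability of the origin for `x'(t) ∈ F t (x t)`, `t ≥ 0`. -/
structure IsGloballyAsymptoticallyStable {E : Type*} [NormedAddCommGroup E] [NormedSpace ℝ E]
    (F : ℝ → E → Set E) : Prop where
  /-- Through every initial state, at every initial time, there is a solution for all
  later times. -/
  exists_solution : ∀ t₀ : ℝ, 0 ≤ t₀ → ∀ x₀ : E,
    ∃ x : ℝ → E, x t₀ = x₀ ∧ IsSolutionOn F x (Ici t₀)
  /-- No solution escapes in finite time: each one can be continued to all later times. -/
  continuation : ∀ t₀ T : ℝ, 0 ≤ t₀ → t₀ < T → ∀ x : ℝ → E, IsSolutionOn F x (Ico t₀ T) →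
    ∃ y : ℝ → E, EqOn x y (Ico t₀ T) ∧ IsSolutionOn F y (Ici t₀)
  /-- The origin is Lyapunov stable. -/
  stable : ∀ ε : ℝ, 0 < ε → ∃ δ : ℝ, 0 < δ ∧ ∀ t₀ : ℝ, 0 ≤ t₀ →
    ∀ x : ℝ → E, IsSolutionOn F x (Ici t₀) → ‖x t₀‖ < δ → ∀ t : ℝ, t₀ ≤ t → ‖x t‖ < ε
  /-- Every solution tends to the origin. -/
  attractive : ∀ t₀ : ℝ, 0 ≤ t₀ → ∀ x : ℝ → E, IsSolutionOn F x (Ici t₀) →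
    Tendsto x atTop (𝓝 0)

/-- The relay: the sign function, filled in by the segment `[-1, 1]` at the jump. -/
def relaySign (y : ℝ) : Set ℝ :=
  {ξ | (0 < y → ξ = 1) ∧ (y < 0 → ξ = -1) ∧ (y = 0 → ξ ∈ Icc (-1 : ℝ) 1)}

/-- The constants of the pendulum on a cart and of its regulator. -/
structure CartPendulum where
  /-- mass of the cart -/
  M : ℝ
  /-- mass of the pendulum -/
  m : ℝ
  /-- length of the pendulum -/
  l : ℝ
  /-- moment of inertia of the pendulum about its centre of mass -/
  J : ℝ
  /-- coefficient of friction for the motion of the pendulum -/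
  κ : ℝ
  /-- coefficient of the moment of the rotational friction of the pendulum -/
  c₀ : ℝ
  /-- acceleration due to gravity -/
  g : ℝ
  /-- amplification of the motor -/
  G : ℝ
  /-- the number `ρ` in the change of variable `s = r + ρ Ω` -/
  ρ : ℝ
  /-- decay rate `a` of the regulator -/
  a : ℝ
  /-- decay rate `α` of the regulator -/
  α : ℝ

namespace CartPendulum

noncomputable section

variable (p : CartPendulum)

def L : ℝ := p.m * p.l

def I : ℝ := p.J + p.m * p.l ^ 2

def c : ℝ := p.c₀ + p.κ * p.l

def A : ℝ := |p.G * (p.I - p.ρ * p.L)|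

def B : ℝ := p.A / p.G

def d₁ : ℝ := (p.κ * p.ρ - p.c) / (p.ρ * p.L - p.I)

def d₂ : ℝ := p.L * p.g / (p.ρ * p.L - p.I)

def d₃ : ℝ := p.I / (p.ρ * p.L - p.I)

/-- The angle `β ∈ (-π/2, π/2)` of the pendulum as a function of `Ω`, that is, the inverse of
`Ω = -ln |tan (π/4 - β/2)|`. -/
def angle (Ω : ℝ) : ℝ := 2 * (Real.pi / 4 - Real.arctan (Real.exp (-Ω)))

def psi (β : ℝ) : ℝ := p.M * p.I - p.L ^ 2 * Real.cos β ^ 2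

/-- The time derivative of `psi β` along a motion, where `β' = Ω' cos β` and `ω = Ω'`. -/
def psiDot (β ω : ℝ) : ℝ := p.L ^ 2 * Real.sin (2 * β) * (ω * Real.cos β)

/-- Right-hand side of the equations of motion at the state `x = (s, γ, Ω, Ω')`, with control
correction `Δu = w` and disturbance `d`. The number `σ` is the coefficient of `s'` in the
equation for `Ω''`. -/
def rhs (σ w d : ℝ) (x : EuclideanSpace ℝ (Fin 4)) : EuclideanSpace ℝ (Fin 4) :=
  let s := x 0
  let γ := x 1
  let Ω := x 2
  let ω := x 3
  let β := angle Ω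
  let sDot := γ / p.psi β - p.α * s
  let γDot := -p.a * γ - p.A * w - p.B * d
  !₂[sDot,
    γDot,
    ω,
    -p.d₁ * ω - p.d₂ * Real.tan β - p.d₃ * ω ^ 2 * Real.sin β
      + p.L / (p.ρ * p.L - p.I) * ((γDot * p.psi β - γ * p.psiDot β ω) / p.psi β ^ 2)
      + σ * sDot]

/-- The closed-loop system with the relay control `Δu = U · sign γ`, as a differential
inclusion: one value `ξ` of the relay enters all equations. -/
def relaySystem (σ U : ℝ) (D : ℝ → ℝ) (t : ℝ) (x : EuclideanSpace ℝ (Fin 4)) :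
    Set (EuclideanSpace ℝ (Fin 4)) :=
  {v | ∃ ξ ∈ relaySign (x 1), v = p.rhs σ (U * ξ) (D t) x}

end

end CartPendulum

/-! The equation for `γ` is decoupled, and since `B = A / G` the relay dominates the disturbance;
hence `γ` decays like `exp (-a (t - t₀))` (`abs_le_mul_exp_of_relay`). The relay and the disturbance
enter the equation for `Ω''` only through the time derivative of `γ / ψ`. Subtracting `coupling * γ
/ ψ` from `Ω'` gives a variable `z` such that `(s, Ω, z)` obeys a smooth equation driven by the
continuous signal `γ` (`hasDerivAt_toReduced`). There `s` is a damped linear variable with decaying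
forcing, and `(Ω, z)` is a damped pendulum with exponentially decaying perturbations `q`, `f`.

The energy `z² / 2 * cosh Ω ^ (2 d₃) + w * cosh Ω ^ (2 d₃ + 1)`, with `w = d₂ / (2 d₃ + 1)`,
dissipates at rate `d₁ z² cosh Ω ^ (2 d₃)` when unperturbed. Perturbations change it at a relative
rate that is integrable in time, so Gronwall's inequality bounds all motions, uniformly in `t₀`
(`exists_bounds`). These bounds shrink with the initial state, which gives stability. On the bounded
set so obtained the cross term `ε z sinh Ω` makes the energy a strict Lyapunov function, which gives
attraction (`tendsto_zero_of_perturbed_pendulum`).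

Existence combines an explicit solution of the relay equation with a truncated reduced equation. The
relay is monotone, so solutions are unique forward in time (`relaySystem_unique`); every local
solution is therefore a piece of a global one. -/

/-! ### Absolutely continuous functions, differential inequalities and global ODE solutions. -/

theorem AbsolutelyContinuousOnInterval.lipschitzOnWith_comp {X Y : Type*} [PseudoMetricSpace X]
    [PseudoMetricSpace Y] {f : ℝ → X} {g : X → Y} {s : Set X} {K : NNReal} {a b : ℝ}
    (hf : AbsolutelyContinuousOnInterval f a b) (hg : LipschitzOnWith K g s)
    (hs : MapsTo f (uIcc a b) s) : AbsolutelyContinuousOnInterval (fun t => g (f t)) a b := by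
  have h := Filter.Tendsto.const_mul (K : ℝ) hf
  rw [mul_zero] at h
  refine squeeze_zero' (Eventually.of_forall fun E => Finset.sum_nonneg fun i _ => dist_nonneg)
    ?_ h
  filter_upwards [mem_inf_of_right (mem_principal_self _)] with E hE
  rw [Finset.mul_sum]
  exact Finset.sum_le_sum fun i hi =>
    hg.dist_le_mul _ (hs (hE.1 i hi).1) _ (hs (hE.1 i hi).2)

theorem AbsolutelyContinuousOnInterval.contDiff_comp {E F : Type*} [NormedAddCommGroup E]
    [NormedSpace ℝ E] [NormedAddCommGroup F] [NormedSpace ℝ F] {f : ℝ → E} {g : E → F} {a b : ℝ}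
    (hf : AbsolutelyContinuousOnInterval f a b) (hg : ContDiff ℝ 1 g) :
    AbsolutelyContinuousOnInterval (fun t => g (f t)) a b := by
  obtain ⟨K, hK⟩ := (hg.locallyLipschitz.locallyLipschitzOn
    (s := f '' uIcc a b)).exists_lipschitzOnWith_of_compact
    (isCompact_uIcc.image_of_continuousOn hf.continuousOn)
  exact hf.lipschitzOnWith_comp hK (mapsTo_image _ _)

/-- An absolutely continuous function with nonpositive derivative almost everywhere does not
increase. -/
theorem AbsolutelyContinuousOnInterval.le_of_ae_hasDerivAt_nonpos {f : ℝ → ℝ} {a b : ℝ}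
    (hab : a ≤ b) (hf : AbsolutelyContinuousOnInterval f a b)
    (hd : ∀ᵐ t : ℝ, t ∈ Icc a b → ∃ v ≤ 0, HasDerivAt f v t) : f b ≤ f a := by
  have h := hf.integral_deriv_eq_sub
  have h2 : ∫ t in a..b, deriv f t ≤ 0 := by
    rw [intervalIntegral.integral_of_le hab]
    refine setIntegral_nonpos_of_ae_restrict ?_
    filter_upwards [ae_restrict_of_ae hd, ae_restrict_mem measurableSet_Ioc] with t ht htm
    obtain ⟨v, hv, hv'⟩ := ht (Ioc_subset_Icc_self htm)
    simpa [hv'.deriv] using hv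
  linarith

/-- An absolutely continuous function whose derivative agrees almost everywhere with a continuous
function is continuously differentiable. -/
theorem AbsolutelyContinuousOnInterval.hasDerivWithinAt_of_ae {E : Type*} [NormedAddCommGroup E]
    [NormedSpace ℝ E] [CompleteSpace E] {f g : ℝ → E} {a b : ℝ}
    (hab : a ≤ b) (hf : AbsolutelyContinuousOnInterval f a b) (hg : ContinuousOn g (Icc a b))
    (hd : ∀ᵐ t : ℝ, t ∈ Icc a b → HasDerivAt f (g t) t) :
    ∀ t ∈ Icc a b, HasDerivWithinAt f (g t) (Icc a b) t := by
  -- The constant extension of `g` beyond the endpoints makes its primitive differentiable on all of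
  -- ℝ; `f` differs from that primitive by a constant.
  set h : ℝ → E := IccExtend hab (domRestrict (Icc a b) g)
  have hh : Continuous h := (continuousOn_iff_continuous_domRestrict.1 hg).Icc_extend'
  have hhg : ∀ t ∈ Icc a b, h t = g t := fun t ht => IccExtend_of_mem hab _ ht
  have hP : ∀ t, HasDerivAt (fun t => ∫ u in a..t, h u) (h t) t := fun t =>
    intervalIntegral.integral_hasDerivAt_right (hh.intervalIntegrable _ _)
      hh.stronglyMeasurable.stronglyMeasurableAtFilter hh.continuousAt
  have hPac : AbsolutelyContinuousOnInterval (fun t => ∫ u in a..t, h u) a b := by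
    refine ContDiffOn.absolutelyContinuousOnInterval (ContDiff.contDiffOn ?_)
    refine contDiff_one_iff_deriv.2 ⟨fun t => (hP t).differentiableAt, ?_⟩
    rwa [show deriv (fun t => ∫ u in a..t, h u) = h from funext fun t => (hP t).deriv]
  obtain ⟨C, hC⟩ := (hf.sub hPac).const_of_ae_hasDerivAt_zero (by
    filter_upwards [hd] with t ht htm
    rw [uIcc_of_le hab] at htm
    have := (ht htm).sub (hP t)
    rwa [hhg t htm, sub_self] at this)
  rw [uIcc_of_le hab] at hC
  intro t ht
  have h1 : HasDerivWithinAt (fun t => (∫ u in a..t, h u) + C) (g t) (Icc a b) t := by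
    rw [← hhg t ht]; exact ((hP t).add_const C).hasDerivWithinAt
  refine h1.congr (fun u hu => ?_) ?_
  · rw [← hC u hu]; simp
  · rw [← hC t ht]; simp

theorem le_of_hasDerivWithinAt_nonpos {f f' : ℝ → ℝ} {a b : ℝ} (hab : a ≤ b)
    (hf : ∀ t ∈ Icc a b, HasDerivWithinAt f (f' t) (Icc a b) t)
    (hf' : ∀ t ∈ Icc a b, f' t ≤ 0) : f b ≤ f a := by
  refine antitoneOn_of_hasDerivWithinAt_nonpos (f' := f') (convex_Icc a b)
    (fun t ht => (hf t ht).continuousWithinAt) (fun t ht => ?_) (fun t ht => ?_)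
    (left_mem_Icc.2 hab) (right_mem_Icc.2 hab) hab
  · exact (hf t (interior_subset ht)).mono interior_subset
  · exact hf' t (interior_subset ht)

/-- Decay of a function subject to a damped differential inequality with a decaying forcing. -/
theorem le_mul_exp_of_hasDerivWithinAt_le {Y Y' : ℝ → ℝ} {a b c k μ : ℝ} (hab : a ≤ b)
    (hμ : μ < c) (hk : 0 ≤ k) (hY : ∀ t ∈ Icc a b, HasDerivWithinAt Y (Y' t) (Icc a b) t)
    (hY' : ∀ t ∈ Icc a b, Y' t ≤ -c * Y t + k * Real.exp (-μ * (t - a))) :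
    Y b ≤ (|Y a| + k / (c - μ)) * Real.exp (-μ * (b - a)) := by
  have hcμ : 0 < c - μ := sub_pos.2 hμ
  -- Integrating factor `exp (c (t - a))`; the subtracted term is a primitive of the forcing times
  -- this factor.
  have key := le_of_hasDerivWithinAt_nonpos
    (f := fun t => Y t * Real.exp (c * (t - a)) - k / (c - μ) * Real.exp ((c - μ) * (t - a)))
    (f' := fun t => (Y' t + c * Y t - k * Real.exp (-μ * (t - a))) * Real.exp (c * (t - a)))
    hab (fun t ht => ?_) (fun t ht => ?_)
  · simp only [sub_self, mul_zero, Real.exp_zero, mul_one] at key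
    have e1 : Real.exp ((c - μ) * (b - a)) = Real.exp (c * (b - a)) * Real.exp (-μ * (b - a)) := by
      rw [← Real.exp_add]; ring_nf
    have e2 : Real.exp (-c * (b - a)) * Real.exp (c * (b - a)) = 1 := by
      rw [← Real.exp_add]; simp
    have e3 : Real.exp (-c * (b - a)) ≤ Real.exp (-μ * (b - a)) :=
      Real.exp_le_exp.2 (by nlinarith)
    rw [e1] at key
    have h1 := mul_le_mul_of_nonneg_left key (Real.exp_pos (-c * (b - a))).le
    have h2 : Real.exp (-c * (b - a)) * (Y b * Real.exp (c * (b - a)) -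
        k / (c - μ) * (Real.exp (c * (b - a)) * Real.exp (-μ * (b - a)))) =
        Y b - k / (c - μ) * Real.exp (-μ * (b - a)) := by
      linear_combination (Y b - k / (c - μ) * Real.exp (-μ * (b - a))) * e2
    have h3 : Real.exp (-c * (b - a)) * (Y a - k / (c - μ)) ≤
        Real.exp (-μ * (b - a)) * |Y a| := by
      have : Y a - k / (c - μ) ≤ |Y a| := by
        have := le_abs_self (Y a); have : 0 ≤ k / (c - μ) := by positivity
        linarith
      calc _ ≤ Real.exp (-c * (b - a)) * |Y a| := by gcongr
        _ ≤ _ := by gcongr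
    linarith
  · have h1 : HasDerivAt (fun t => Real.exp (c * (t - a))) (Real.exp (c * (t - a)) * c) t := by
      simpa using (((hasDerivAt_id t).sub_const a).const_mul c).exp
    have h2 : HasDerivAt (fun t => Real.exp ((c - μ) * (t - a)))
        (Real.exp ((c - μ) * (t - a)) * (c - μ)) t := by
      simpa using (((hasDerivAt_id t).sub_const a).const_mul (c - μ)).exp
    refine (((hY t ht).mul h1.hasDerivWithinAt).sub
      (h2.const_mul (k / (c - μ))).hasDerivWithinAt).congr_deriv ?_
    have e1 : Real.exp ((c - μ) * (t - a)) = Real.exp (c * (t - a)) * Real.exp (-μ * (t - a)) := by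
      rw [← Real.exp_add]; ring_nf
    rw [e1]
    field_simp
  · exact mul_nonpos_of_nonpos_of_nonneg (by linarith [hY' t ht]) (Real.exp_pos _).le

/-- Gronwall's inequality with an exponentially decaying rate. -/
theorem le_mul_exp_of_hasDerivWithinAt_le_mul {W W' : ℝ → ℝ} {a b k μ : ℝ} (hab : a ≤ b)
    (hμ : 0 < μ) (hk : 0 ≤ k) (hW0 : 0 ≤ W a)
    (hW : ∀ t ∈ Icc a b, HasDerivWithinAt W (W' t) (Icc a b) t)
    (hW' : ∀ t ∈ Icc a b, W' t ≤ k * Real.exp (-μ * (t - a)) * W t) :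
    W b ≤ W a * Real.exp (k / μ) := by
  -- The exponent of the factor has derivative `-k exp (-μ (t - a))`, which cancels the growth rate;
  -- it falls from `k / μ` but stays nonnegative.
  have key := le_of_hasDerivWithinAt_nonpos
    (f := fun t => W t * Real.exp (k / μ * Real.exp (-μ * (t - a))))
    (f' := fun t => (W' t - k * Real.exp (-μ * (t - a)) * W t) *
      Real.exp (k / μ * Real.exp (-μ * (t - a))))
    hab (fun t ht => ?_) (fun t ht => ?_)
  · simp only [sub_self, mul_zero, Real.exp_zero, mul_one] at key
    by_cases hb : W b ≤ 0
    · exact hb.trans (by positivity)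
    · refine le_trans ?_ key
      exact le_mul_of_one_le_right (not_le.1 hb).le (Real.one_le_exp (by positivity))
  · have h1 : HasDerivAt (fun t => Real.exp (-μ * (t - a))) (Real.exp (-μ * (t - a)) * -μ) t := by
      simpa using (((hasDerivAt_id t).sub_const a).const_mul (-μ)).exp
    refine ((hW t ht).mul (h1.const_mul (k / μ)).exp.hasDerivWithinAt).congr_deriv ?_
    field_simp
    ring
  · exact mul_nonpos_of_nonpos_of_nonneg (by linarith [hW' t ht]) (Real.exp_pos _).le

/-- A continuous function that stays strictly below a level as long as it has not exceeded it
never reaches it. -/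
theorem lt_of_forall_le_imp_lt {N : ℝ → ℝ} {a b R : ℝ} (hN : ContinuousOn N (Icc a b))
    (ha : N a < R)
    (h : ∀ t ∈ Icc a b, (∀ u ∈ Icc a t, N u ≤ R) → N t < R) : ∀ t ∈ Icc a b, N t < R := by
  intro t ht
  by_contra hc
  rw [not_lt] at hc
  have hK : IsCompact (Icc a b ∩ N ⁻¹' Ici R) :=
    isCompact_Icc.of_isClosed_subset (hN.preimage_isClosed_of_isClosed isClosed_Icc isClosed_Ici)
      inter_subset_left
  -- `τ` is the first time at which `N ≥ R`; by continuity `N τ = R`, so `h` applies at `τ` and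
  -- contradicts this.
  obtain ⟨τ, ⟨hτ, hτR⟩, hmin⟩ := hK.exists_isLeast ⟨t, ht, hc⟩
  have hsub : Icc a τ ⊆ Icc a b := Icc_subset_Icc_right hτ.2
  have hle : N τ ≤ R := by
    obtain ⟨u, hu, huR⟩ := intermediate_value_Icc hτ.1 (hN.mono hsub) ⟨ha.le, hτR⟩
    rw [← le_antisymm hu.2 (hmin ⟨hsub hu, huR.ge⟩)]
    exact huR.le
  refine absurd (h τ hτ fun u hu => ?_) (not_lt.2 hτR)
  by_contra hcu
  rw [not_le] at hcu
  have : u = τ := le_antisymm hu.2 (hmin ⟨hsub hu, hcu.le⟩)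
  exact absurd hle (not_le.2 (this ▸ hcu))

/-- A bounded vector field that is Lipschitz in space and continuous in time has solutions
defined for all times. -/
theorem exists_forall_hasDerivAt_of_lipschitzWith {E : Type*} [NormedAddCommGroup E]
    [NormedSpace ℝ E] [CompleteSpace E] {f : ℝ → E → E} {K B : NNReal}
    (hK : ∀ t, LipschitzWith K (f t)) (hc : ∀ x, Continuous fun t => f t x)
    (hB : ∀ t x, ‖f t x‖ ≤ B) (t₀ : ℝ) (x₀ : E) :
    ∃ y : ℝ → E, y t₀ = x₀ ∧ ∀ t, HasDerivAt y (f t (y t)) t := by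
  have hex : ∀ n : ℕ, ∃ y : ℝ → E, y t₀ = x₀ ∧
      ∀ t ∈ Icc (t₀ - n) (t₀ + n), HasDerivWithinAt y (f t (y t)) (Icc (t₀ - n) (t₀ + n)) t := by
    intro n
    have hn : (0 : ℝ) ≤ n := n.cast_nonneg
    -- Speed at most `B` for a time at most `n` cannot leave the ball of radius `B * n`, so the
    -- whole interval is admissible.
    have hP : IsPicardLindelof f (⟨t₀, by constructor <;> linarith⟩ : Icc (t₀ - n) (t₀ + n)) x₀
        (B * n) 0 B K :=
      { lipschitzOnWith := fun t _ => (hK t).lipschitzOnWith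
        continuousOn := fun x _ => (hc x).continuousOn
        norm_le := fun t _ x _ => hB t x
        mul_max_le := by simp }
    exact hP.exists_eq_forall_mem_Icc_hasDerivWithinAt₀
  choose y hy0 hy using hex
  have hyd : ∀ n : ℕ, ∀ t ∈ Ioo (t₀ - n) (t₀ + n), HasDerivAt (y n) (f t (y n t)) t :=
    fun n t ht => (hy n t (Ioo_subset_Icc_self ht)).hasDerivAt (Icc_mem_nhds ht.1 ht.2)
  have huniq : ∀ m n : ℕ, 0 < m → m ≤ n → EqOn (y m) (y n) (Ioo (t₀ - m) (t₀ + m)) := by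
    intro m n hm hmn
    have hmn' : (m : ℝ) ≤ n := by exact_mod_cast hmn
    have hm' : (0 : ℝ) < m := by exact_mod_cast hm
    exact ODE_solution_unique_of_mem_Ioo (v := f) (s := fun _ => univ) (K := K) (t₀ := t₀)
      (fun t _ => (hK t).lipschitzOnWith) ⟨by linarith, by linarith⟩
      (fun t ht => ⟨hyd m t ht, mem_univ _⟩)
      (fun t ht => ⟨hyd n t ⟨by linarith [ht.1], by linarith [ht.2]⟩, mem_univ _⟩)
      ((hy0 m).trans (hy0 n).symm)
  have hpos : ∀ t : ℝ, 0 < ⌈|t - t₀|⌉₊ + 1 := fun t => Nat.succ_pos _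
  have hmem : ∀ t : ℝ, ∀ n : ℕ, |t - t₀| < n → t ∈ Ioo (t₀ - n) (t₀ + n) := fun t n h =>
    ⟨by linarith [(abs_lt.1 h).1], by linarith [(abs_lt.1 h).2]⟩
  have hceil : ∀ t : ℝ, |t - t₀| < ((⌈|t - t₀|⌉₊ + 1 : ℕ) : ℝ) := fun t => by
    push_cast; linarith [Nat.le_ceil |t - t₀|]
  have heq : ∀ n : ℕ, 0 < n → ∀ t ∈ Ioo (t₀ - n) (t₀ + n), y (⌈|t - t₀|⌉₊ + 1) t = y n t := by
    intro n hn t ht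
    rcases le_total n (⌈|t - t₀|⌉₊ + 1) with h | h
    · exact (huniq n _ hn h ht).symm
    · exact huniq _ n (hpos t) h (hmem t _ (hceil t))
  -- The `+ 1` places `t` strictly inside the window whose solution is used, so that derivatives
  -- there are two-sided.
  refine ⟨fun t => y (⌈|t - t₀|⌉₊ + 1) t, hy0 _, fun t => ?_⟩
  have hd := hyd _ t (hmem t _ (hceil t))
  refine hd.congr_of_eventuallyEq ?_
  filter_upwards [isOpen_Ioo.mem_nhds (hmem t _ (hceil t))] with u hu
  exact heq _ (hpos t) u hu

/-! ### The scalar relay equation: decay, uniqueness and existence. -/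

theorem mul_eq_abs_of_mem_relaySign {y ξ : ℝ} (h : ξ ∈ relaySign y) : y * ξ = |y| := by
  rcases lt_trichotomy y 0 with hy | hy | hy
  · rw [h.2.1 hy, abs_of_neg hy]; ring
  · simp [hy]
  · rw [h.1 hy, abs_of_pos hy]; ring

theorem abs_le_one_of_mem_relaySign {y ξ : ℝ} (h : ξ ∈ relaySign y) : |ξ| ≤ 1 := by
  rcases lt_trichotomy y 0 with hy | hy | hy
  · simp [h.2.1 hy]
  · exact abs_le.2 (h.2.2 hy)
  · simp [h.1 hy]

theorem neg_mem_relaySign_neg {y ξ : ℝ} (h : ξ ∈ relaySign y) : -ξ ∈ relaySign (-y) := by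
  refine ⟨fun hy => ?_, fun hy => ?_, fun hy => ?_⟩
  · rw [h.2.1 (neg_pos.1 hy), neg_neg]
  · rw [h.1 (neg_lt_zero.1 hy)]
  · have := h.2.2 (neg_eq_zero.1 hy)
    exact ⟨neg_le_neg this.2, neg_le.2 this.1⟩

/-- Each `yᵢ ξᵢ = |yᵢ|` dominates the cross product of `yᵢ` with the other relay value, since relay
values have modulus at most one. This monotonicity replaces a Lipschitz condition in the uniqueness
argument. -/
theorem relaySign_monotone {y₁ y₂ ξ₁ ξ₂ : ℝ} (h₁ : ξ₁ ∈ relaySign y₁) (h₂ : ξ₂ ∈ relaySign y₂) :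
    0 ≤ (y₁ - y₂) * (ξ₁ - ξ₂) := by
  have a1 : y₁ * ξ₂ ≤ |y₁| := (le_abs_self _).trans (by
    rw [abs_mul]; exact mul_le_of_le_one_right (abs_nonneg _) (abs_le_one_of_mem_relaySign h₂))
  have a2 : y₂ * ξ₁ ≤ |y₂| := (le_abs_self _).trans (by
    rw [abs_mul]; exact mul_le_of_le_one_right (abs_nonneg _) (abs_le_one_of_mem_relaySign h₁))
  linarith [mul_eq_abs_of_mem_relaySign h₁, mul_eq_abs_of_mem_relaySign h₂,
    show (y₁ - y₂) * (ξ₁ - ξ₂) = y₁ * ξ₁ + y₂ * ξ₂ - y₁ * ξ₂ - y₂ * ξ₁ by ring]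

/-- A relay that dominates the disturbance makes the scalar state decay exponentially. -/
theorem abs_le_mul_exp_of_relay {a κ t₀ b : ℝ} {h γ : ℝ → ℝ} (hb : t₀ ≤ b)
    (hac : AbsolutelyContinuousOnInterval γ t₀ b) (hh : ∀ t ∈ Icc t₀ b, |h t| ≤ κ)
    (hd : ∀ᵐ t : ℝ, t ∈ Icc t₀ b → ∃ ξ ∈ relaySign (γ t),
      HasDerivAt γ (-a * γ t - κ * ξ - h t) t) :
    |γ b| ≤ |γ t₀| * Real.exp (-a * (b - t₀)) := by
  have he : AbsolutelyContinuousOnInterval (fun t => Real.exp (a * (t - t₀))) t₀ b :=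
    ContDiffOn.absolutelyContinuousOnInterval (by fun_prop)
  -- The monotone quantity is the square of `γ exp (a (t - t₀))`, which avoids the corner of `|γ|`
  -- at zero.
  have key := (((hac.mul he).mul (hac.mul he))).le_of_ae_hasDerivAt_nonpos hb (by
    filter_upwards [hd] with t ht htm
    obtain ⟨ξ, hξ, hγ⟩ := ht htm
    have h1 : HasDerivAt (fun t => Real.exp (a * (t - t₀))) (Real.exp (a * (t - t₀)) * a) t := by
      simpa using (((hasDerivAt_id t).sub_const t₀).const_mul a).exp
    have h2 := hγ.mul h1
    refine ⟨_, ?_, h2.mul h2⟩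
    have h3 : -(γ t * h t) ≤ |γ t| * κ := by
      refine (neg_le_abs _).trans ?_
      rw [abs_mul]
      exact mul_le_mul_of_nonneg_left (hh t htm) (abs_nonneg _)
    have h4 := mul_eq_abs_of_mem_relaySign hξ
    have h5 := Real.exp_pos (a * (t - t₀))
    simp only [Pi.mul_apply]
    have h6 : 2 * Real.exp (a * (t - t₀)) ^ 2 * (-(κ * (γ t * ξ)) - γ t * h t) ≤ 0 := by
      refine mul_nonpos_of_nonneg_of_nonpos (by positivity) ?_
      rw [h4]; linarith
    refine le_trans (le_of_eq ?_) h6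
    ring)
  simp only [Pi.mul_apply, sub_self, mul_zero, Real.exp_zero, mul_one] at key
  have h7 : |γ b * Real.exp (a * (b - t₀))| ≤ |γ t₀| :=
    sq_le_sq.1 (by simpa only [sq] using key)
  rw [abs_mul, Real.abs_exp] at h7
  have h8 := mul_le_mul_of_nonneg_right h7 (Real.exp_pos (-a * (b - t₀))).le
  rwa [mul_assoc, ← Real.exp_add, show a * (b - t₀) + -a * (b - t₀) = 0 by ring, Real.exp_zero,
    mul_one] at h8

/-- In the derivative of `(γ₁ - γ₂)²` the term `h` cancels, and monotonicity of the relay makes the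
rest nonpositive. -/
theorem relay_unique {a κ t₀ b : ℝ} {h γ₁ γ₂ : ℝ → ℝ} (ha : 0 ≤ a) (hκ : 0 ≤ κ) (hb : t₀ ≤ b)
    (hac₁ : AbsolutelyContinuousOnInterval γ₁ t₀ b)
    (hac₂ : AbsolutelyContinuousOnInterval γ₂ t₀ b)
    (hd₁ : ∀ᵐ t : ℝ, t ∈ Icc t₀ b → ∃ ξ ∈ relaySign (γ₁ t),
      HasDerivAt γ₁ (-a * γ₁ t - κ * ξ - h t) t)
    (hd₂ : ∀ᵐ t : ℝ, t ∈ Icc t₀ b → ∃ ξ ∈ relaySign (γ₂ t),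
      HasDerivAt γ₂ (-a * γ₂ t - κ * ξ - h t) t)
    (h0 : γ₁ t₀ = γ₂ t₀) : γ₁ b = γ₂ b := by
  have hs := hac₁.sub hac₂
  have key := (hs.mul hs).le_of_ae_hasDerivAt_nonpos hb (by
    filter_upwards [hd₁, hd₂] with t ht₁ ht₂ htm
    obtain ⟨ξ₁, hξ₁, hγ₁⟩ := ht₁ htm
    obtain ⟨ξ₂, hξ₂, hγ₂⟩ := ht₂ htm
    have h2 := hγ₁.sub hγ₂
    refine ⟨_, ?_, h2.mul h2⟩
    simp only [Pi.sub_apply]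
    have h3 := mul_nonneg hκ (relaySign_monotone hξ₁ hξ₂)
    have h4 := mul_nonneg ha (sq_nonneg (γ₁ t - γ₂ t))
    linarith)
  simp only [Pi.mul_apply, Pi.sub_apply, h0, sub_self, mul_zero] at key
  exact sub_eq_zero.1 (mul_self_eq_zero.1 (le_antisymm key (mul_self_nonneg _)))

/-- Variation of constants with `ξ = 1`, cut off at zero, is an explicit solution. Where the cut-off
acts, `γ` is at its minimum, so its derivative vanishes wherever it exists, and the relay value only
has to balance `h`. -/
theorem exists_relay_solution_of_nonneg {a κ t₀ γ₀ : ℝ} {h : ℝ → ℝ} (hγ₀ : 0 ≤ γ₀)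
    (hc : Continuous h) (hh : ∀ t, |h t| ≤ κ) :
    ∃ γ : ℝ → ℝ, Continuous γ ∧ γ t₀ = γ₀ ∧
      (∀ t₁ t₂ : ℝ, AbsolutelyContinuousOnInterval γ t₁ t₂) ∧
      ∀ᵐ t : ℝ, ∃ ξ ∈ relaySign (γ t), HasDerivAt γ (-a * γ t - κ * ξ - h t) t := by
  set k : ℝ → ℝ := fun t => Real.exp (a * (t - t₀)) * (κ + h t) with hk
  have hkc : Continuous k := by fun_prop
  set H : ℝ → ℝ := fun t => ∫ u in t₀..t, k u with hH
  have hHd : ∀ t, HasDerivAt H (k t) t := fun t =>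
    intervalIntegral.integral_hasDerivAt_right (hkc.intervalIntegrable _ _)
      hkc.stronglyMeasurable.stronglyMeasurableAtFilter hkc.continuousAt
  have hHc : ContDiff ℝ 1 H := by
    refine contDiff_one_iff_deriv.2 ⟨fun t => (hHd t).differentiableAt, ?_⟩
    rwa [show deriv H = k from funext fun t => (hHd t).deriv]
  have hHcont : Continuous H := hHc.continuous
  set e : ℝ → ℝ := fun t => Real.exp (-a * (t - t₀)) with he
  set γ : ℝ → ℝ := fun t => e t * max 0 (γ₀ - H t) with hγ
  have hed : ∀ t, HasDerivAt e (e t * -a) t := fun t => by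
    simpa [he] using (((hasDerivAt_id t).sub_const t₀).const_mul (-a)).exp
  have hac : ∀ t₁ t₂ : ℝ, AbsolutelyContinuousOnInterval γ t₁ t₂ := by
    intro t₁ t₂
    have h1 : AbsolutelyContinuousOnInterval e t₁ t₂ :=
      ContDiffOn.absolutelyContinuousOnInterval (by fun_prop)
    have h2 : AbsolutelyContinuousOnInterval (fun t => γ₀ - H t) t₁ t₂ :=
      ContDiffOn.absolutelyContinuousOnInterval (contDiff_const.sub hHc).contDiffOn
    have h3 : LipschitzWith 1 (fun x : ℝ => max 0 x) := by
      simpa using LipschitzWith.id.const_max (0 : ℝ)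
    exact h1.mul (h2.lipschitzOnWith_comp (h3.lipschitzOnWith (s := univ)) (mapsTo_univ _ _))
  have hdiff : ∀ᵐ t : ℝ, DifferentiableAt ℝ γ t := by
    have h1 : ∀ n : ℕ, ∀ᵐ t : ℝ, t ∈ uIcc (-(n : ℝ)) n → DifferentiableAt ℝ γ t :=
      fun n => (hac _ _).ae_differentiableAt
    filter_upwards [ae_all_iff.2 h1] with t ht
    obtain ⟨n, hn⟩ := exists_nat_ge |t|
    refine ht n ?_
    rw [uIcc_of_le (by linarith [abs_nonneg t])]
    exact abs_le.1 hn
  refine ⟨γ, by fun_prop, by simp [hγ, he, hH, hγ₀], hac, ?_⟩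
  filter_upwards [hdiff] with t ht
  by_cases hp : 0 < γ₀ - H t
  · refine ⟨1, ⟨fun _ => rfl, fun hn => ?_, fun hn => by norm_num⟩, ?_⟩
    · exact absurd hn (not_lt.2 (mul_nonneg (Real.exp_pos _).le (le_max_left _ _)))
    · have h1 := (hed t).mul ((hHd t).const_sub γ₀)
      have h2 : γ =ᶠ[𝓝 t] fun t => e t * (γ₀ - H t) := by
        filter_upwards [(isOpen_Ioi.preimage (continuous_const.sub hHcont)).mem_nhds
          (show t ∈ (fun t => γ₀ - H t) ⁻¹' Ioi 0 from hp)] with u hu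
        simp only [hγ, max_eq_right (le_of_lt (show 0 < γ₀ - H u from hu))]
      refine (h1.congr_of_eventuallyEq h2).congr_deriv ?_
      have h3 : e t * Real.exp (a * (t - t₀)) = 1 := by
        rw [he, ← Real.exp_add]; simp
      simp only [hγ, hk, max_eq_right hp.le]
      linear_combination (-(κ + h t)) * h3
  · have h0 : γ t = 0 := by simp [hγ, max_eq_left (not_lt.1 hp)]
    have hmin : IsLocalMin γ t := Eventually.of_forall fun u => by
      rw [h0]; exact mul_nonneg (Real.exp_pos _).le (le_max_left _ _)
    have hd0 : HasDerivAt γ 0 t := by rw [← hmin.deriv_eq_zero]; exact ht.hasDerivAt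
    have hκ : 0 ≤ κ := (abs_nonneg _).trans (hh t)
    -- The sliding value of the relay. For `κ = 0` the quotient is `0` by convention, which still
    -- works because then `h t = 0`.
    refine ⟨-h t / κ, ⟨fun hn => absurd h0 hn.ne', fun hn => absurd h0 hn.ne, fun _ => ?_⟩, ?_⟩
    · refine abs_le.1 ?_
      rw [abs_div, abs_neg, abs_of_nonneg hκ]
      exact div_le_one_of_le₀ (hh t) hκ
    · refine hd0.congr_deriv ?_
      rw [h0]
      rcases hκ.eq_or_lt with h₀ | h₀
      · have : h t = 0 := abs_nonpos_iff.1 ((hh t).trans h₀.ge)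
        simp [this]
      · field_simp; ring

theorem exists_relay_solution {a κ t₀ γ₀ : ℝ} {h : ℝ → ℝ}
    (hc : Continuous h) (hh : ∀ t, |h t| ≤ κ) :
    ∃ γ : ℝ → ℝ, Continuous γ ∧ γ t₀ = γ₀ ∧
      (∀ t₁ t₂ : ℝ, AbsolutelyContinuousOnInterval γ t₁ t₂) ∧
      ∀ᵐ t : ℝ, ∃ ξ ∈ relaySign (γ t), HasDerivAt γ (-a * γ t - κ * ξ - h t) t := by
  rcases le_total 0 γ₀ with h0 | h0
  · exact exists_relay_solution_of_nonneg h0 hc hh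
  · obtain ⟨γ, h1, h2, h3, h4⟩ := exists_relay_solution_of_nonneg (a := a) (κ := κ) (t₀ := t₀)
      (neg_nonneg.2 h0) hc.neg (by simpa using hh)
    refine ⟨-γ, h1.neg, by simp [h2], fun t₁ t₂ => (h3 t₁ t₂).neg, ?_⟩
    filter_upwards [h4] with t ⟨ξ, hξ, hd⟩
    refine ⟨-ξ, neg_mem_relaySign_neg hξ, hd.neg.congr_deriv ?_⟩
    simp only [Pi.neg_apply]
    ring

/-! ### The pendulum energy and its growth under perturbations. -/

theorem one_add_sq_div_two_le_cosh (x : ℝ) : 1 + x ^ 2 / 2 ≤ Real.cosh x := by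
  have h1 : Real.cosh x = 1 + 2 * Real.sinh (x / 2) ^ 2 := by
    have h := Real.cosh_two_mul (x / 2)
    rw [Real.cosh_sq, show 2 * (x / 2) = x by ring] at h
    linarith
  have h2 : (x / 2) ^ 2 ≤ Real.sinh (x / 2) ^ 2 := by
    refine sq_le_sq.2 ?_
    rw [Real.abs_sinh]
    exact Real.self_le_sinh_iff.2 (abs_nonneg _)
  rw [h1]
  linarith

theorem abs_sinh_le_cosh (x : ℝ) : |Real.sinh x| ≤ Real.cosh x :=
  abs_le_of_sq_le_sq (by rw [Real.cosh_sq]; linarith) (Real.cosh_pos x).le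

/-- Bernoulli's inequality for `x⁻¹` in place of `x`, multiplied by `x ^ r`, turns a lower bound
into an upper one. -/
theorem rpow_sub_one_le_mul_sub_one {x r : ℝ} (hx : 1 ≤ x) (hr : 1 ≤ r) :
    x ^ r - 1 ≤ r * x ^ r * (x - 1) := by
  have hx0 : 0 < x := by linarith
  have h := one_add_mul_self_le_rpow_one_add (s := x⁻¹ - 1) (by
    have := inv_pos.2 hx0; linarith) hr
  rw [show 1 + (x⁻¹ - 1) = x⁻¹ by ring, Real.inv_rpow hx0.le] at h
  have hp : 0 < x ^ r := Real.rpow_pos_of_pos hx0 r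
  have h2 := mul_le_mul_of_nonneg_right h hp.le
  rw [inv_mul_cancel₀ hp.ne'] at h2
  have h3 : 1 - x⁻¹ ≤ x - 1 := by
    have : x⁻¹ * x = 1 := inv_mul_cancel₀ hx0.ne'
    nlinarith [inv_pos.2 hx0]
  have h4 := mul_le_mul_of_nonneg_left h3 (mul_nonneg (by linarith : (0:ℝ) ≤ r) hp.le)
  linarith

/-- Energy of the pendulum in the variable `Ω`, with momentum `z`. -/
noncomputable def pendulumEnergy (n w Ω z : ℝ) : ℝ :=
  z ^ 2 / 2 * Real.cosh Ω ^ n + w * Real.cosh Ω ^ (n + 1)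

/-- Rate of change of the energy divided by `cosh Ω ^ n`, under perturbations `q` of the
velocity and `f` of the force. -/
noncomputable def energyRate (d₁ d₂ d₃ Ω z q f : ℝ) : ℝ :=
  -d₁ * z ^ 2 - d₁ * z * q - d₃ * z * (Real.sinh Ω / Real.cosh Ω) * (z + q) * q + z * f
    + d₂ * Real.sinh Ω * q

/-- Acceleration of the pendulum. -/
noncomputable def pendulumForce (d₁ d₂ d₃ Ω v f : ℝ) : ℝ :=
  -d₁ * v - d₂ * Real.sinh Ω - d₃ * v ^ 2 * (Real.sinh Ω / Real.cosh Ω) + f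

/-- The weight `cosh Ω ^ (2 d₃)` is an integrating factor for the term `d₃ v² tanh Ω`, and `hw`
matches the potential to the force `d₂ sinh Ω`. Besides `-d₁ z²`, only terms containing `q` or `f`
survive. -/
theorem hasDerivWithinAt_pendulumEnergy {d₁ d₂ d₃ w q f t : ℝ} {Ω z : ℝ → ℝ} {s : Set ℝ}
    (hw : w * (2 * d₃ + 1) = d₂) (hΩ : HasDerivWithinAt Ω (z t + q) s t)
    (hz : HasDerivWithinAt z (pendulumForce d₁ d₂ d₃ (Ω t) (z t + q) f) s t) :
    HasDerivWithinAt (fun t => pendulumEnergy (2 * d₃) w (Ω t) (z t))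
      (Real.cosh (Ω t) ^ (2 * d₃) * energyRate d₁ d₂ d₃ (Ω t) (z t) q f) s t := by
  have hC := Real.cosh_pos (Ω t)
  have h1 := fun r : ℝ => hΩ.cosh.rpow_const (p := r) (Or.inl hC.ne')
  have h2 := (((hz.pow 2).div_const 2).mul (h1 (2 * d₃))).add ((h1 (2 * d₃ + 1)).const_mul w)
  refine h2.congr_deriv ?_
  rw [Real.rpow_sub_one hC.ne', show 2 * d₃ + 1 - 1 = 2 * d₃ by ring]
  simp only [energyRate, pendulumForce, Pi.pow_apply]
  set X := Real.cosh (Ω t) ^ (2 * d₃)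
  field_simp
  rw [← hw]
  push_cast
  ring

/-- Times the weight, each of `|z|`, `z²` and `cosh Ω` is at most a multiple of the energy, so the
relative growth rate is controlled by `e` alone. No bound on the motion is presupposed; the damping
is discarded. -/
theorem energyRate_mul_le {d₁ d₂ d₃ w Ω z q f e : ℝ} (hd₁ : 0 ≤ d₁) (hd₂ : 0 ≤ d₂) (hd₃ : 0 ≤ d₃)
    (hw : 0 < w) (hq : |q| ≤ e) (hf : |f| ≤ e) :
    Real.cosh Ω ^ (2 * d₃) * energyRate d₁ d₂ d₃ Ω z q f ≤
      (d₁ * (1 + 1 / w) + 2 * d₃ + d₃ * (1 + 1 / w) + (1 + 1 / w) + d₂ / w) * (e * (1 + e)) *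
        pendulumEnergy (2 * d₃) w Ω z := by
  have he : 0 ≤ e := (abs_nonneg _).trans hq
  have hC := Real.cosh_pos Ω
  have hS := abs_sinh_le_cosh Ω
  have hT : |Real.sinh Ω / Real.cosh Ω| ≤ 1 := by
    rw [abs_div, abs_of_pos hC]; exact div_le_one_of_le₀ hS hC.le
  have hC1 := Real.one_le_cosh Ω
  unfold pendulumEnergy energyRate
  rw [Real.rpow_add_one hC.ne']
  have hX : 0 < Real.cosh Ω ^ (2 * d₃) := Real.rpow_pos_of_pos hC _
  set X := Real.cosh Ω ^ (2 * d₃)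
  set C := Real.cosh Ω
  set S := Real.sinh Ω
  set T := S / C
  set W := z ^ 2 / 2 * X + w * (X * C) with hW
  have hXC : X * C ≤ W / w := by
    rw [le_div_iff₀ hw, hW]; nlinarith [mul_nonneg (sq_nonneg z) hX.le]
  have hXw : X ≤ W / w := le_trans (le_mul_of_one_le_right hX.le hC1) hXC
  have hzz : z ^ 2 * X ≤ 2 * W := by
    rw [hW]; have : 0 < w * (X * C) := by positivity
    linarith
  have hW0 : 0 ≤ W := by positivity
  have hz : |z| * X ≤ (1 + 1 / w) * W := by
    have h1 : |z| ≤ (1 + z ^ 2) / 2 := by nlinarith [sq_nonneg (|z| - 1), sq_abs z]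
    have h2 := mul_le_mul_of_nonneg_right h1 hX.le
    have h3 : 0 ≤ W / w := by positivity
    have h4 : (1 + 1 / w) * W = W + W / w := by ring
    linarith
  have t1 : -d₁ * z ^ 2 ≤ 0 := by nlinarith [mul_nonneg hd₁ (sq_nonneg z)]
  have t2 : -(d₁ * z * q) ≤ d₁ * |z| * e := by
    refine (neg_le_abs _).trans ?_
    rw [abs_mul, abs_mul, abs_of_nonneg hd₁]; gcongr
  have t3 : -(d₃ * z * T * (z + q) * q) ≤ d₃ * |z| * 1 * (|z| + e) * e := by
    refine (neg_le_abs _).trans ?_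
    rw [abs_mul, abs_mul, abs_mul, abs_mul, abs_of_nonneg hd₃]
    have := (abs_add_le z q).trans (add_le_add_right hq |z|)
    gcongr
  have t4 : z * f ≤ |z| * e := by
    refine (le_abs_self _).trans ?_
    rw [abs_mul]; gcongr
  have t5 : d₂ * S * q ≤ d₂ * C * e := by
    refine (le_abs_self _).trans ?_
    rw [abs_mul, abs_mul, abs_of_nonneg hd₂]; gcongr
  have h0 : X * (-d₁ * z ^ 2 - d₁ * z * q - d₃ * z * T * (z + q) * q + z * f + d₂ * S * q) ≤
      X * (d₁ * |z| * e + d₃ * |z| * 1 * (|z| + e) * e + |z| * e + d₂ * C * e) :=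
    mul_le_mul_of_nonneg_left (by linarith) hX.le
  refine h0.trans ?_
  have e1 : X * (d₁ * |z| * e + d₃ * |z| * 1 * (|z| + e) * e + |z| * e + d₂ * C * e) =
      e * (d₁ * (|z| * X) + d₃ * (z ^ 2 * X) + d₃ * e * (|z| * X) + |z| * X + d₂ * (X * C)) := by
    rw [← sq_abs z]; ring
  rw [e1]
  have h5 : e * (d₁ * (|z| * X) + d₃ * (z ^ 2 * X) + d₃ * e * (|z| * X) + |z| * X + d₂ * (X * C)) ≤
      e * (d₁ * ((1 + 1 / w) * W) + d₃ * (2 * W) + d₃ * e * ((1 + 1 / w) * W) + (1 + 1 / w) * W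
        + d₂ * (W / w)) := by
    gcongr
  refine h5.trans ?_
  rw [← sub_nonneg]
  have e2 : (d₁ * (1 + 1 / w) + 2 * d₃ + d₃ * (1 + 1 / w) + (1 + 1 / w) + d₂ / w) * (e * (1 + e)) * W
      - e * (d₁ * ((1 + 1 / w) * W) + d₃ * (2 * W) + d₃ * e * ((1 + 1 / w) * W) + (1 + 1 / w) * W
        + d₂ * (W / w)) = e * W * (d₃ * (1 + 1 / w)
        + e * (d₁ * (1 + 1 / w) + 2 * d₃ + (1 + 1 / w) + d₂ / w)) := by ring
  rw [e2]
  positivity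

/-! ### Strict dissipation on bounded sets and convergence. -/

/-- Strict Lyapunov function of the pendulum on bounded sets. -/
noncomputable def strictEnergy (n w ε Ω z : ℝ) : ℝ :=
  pendulumEnergy n w Ω z - w + ε * (z * Real.sinh Ω)

theorem hasDerivWithinAt_strictEnergy {d₁ d₂ d₃ w ε q f t : ℝ} {Ω z : ℝ → ℝ} {s : Set ℝ}
    (hw : w * (2 * d₃ + 1) = d₂) (hΩ : HasDerivWithinAt Ω (z t + q) s t)
    (hz : HasDerivWithinAt z (pendulumForce d₁ d₂ d₃ (Ω t) (z t + q) f) s t) :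
    HasDerivWithinAt (fun t => strictEnergy (2 * d₃) w ε (Ω t) (z t))
      (Real.cosh (Ω t) ^ (2 * d₃) * energyRate d₁ d₂ d₃ (Ω t) (z t) q f
        + ε * (pendulumForce d₁ d₂ d₃ (Ω t) (z t + q) f * Real.sinh (Ω t)
          + z t * (Real.cosh (Ω t) * (z t + q)))) s t :=
  ((hasDerivWithinAt_pendulumEnergy hw hΩ hz).sub_const w).add ((hz.mul hΩ.sinh).const_mul ε)

/-- The cross term is at least `-ε (z² + sinh² Ω) / 2`. The kinetic part absorbs `z²`, and the
potential absorbs `sinh² Ω = (cosh Ω - 1) (cosh Ω + 1)`. -/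
theorem le_strictEnergy {n w ε R Ω z : ℝ} (hn : 0 ≤ n) (hw : 0 < w) (hε : 0 < ε)
    (hε₁ : ε ≤ 1 / 2) (hε₂ : ε * (Real.cosh R + 1) ≤ w) (hΩ : |Ω| ≤ R) :
    z ^ 2 / 4 + w / 4 * Ω ^ 2 ≤ strictEnergy n w ε Ω z := by
  have hR : Real.cosh Ω ≤ Real.cosh R := Real.cosh_le_cosh.2 (hΩ.trans (le_abs_self R))
  have hC := Real.cosh_pos Ω
  have hC1 := Real.one_le_cosh Ω
  have hC2 := one_add_sq_div_two_le_cosh Ω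
  have hS := Real.sinh_sq Ω
  unfold strictEnergy pendulumEnergy
  rw [Real.rpow_add_one hC.ne']
  have hX : 1 ≤ Real.cosh Ω ^ n := Real.one_le_rpow hC1 hn
  set X := Real.cosh Ω ^ n
  set C := Real.cosh Ω
  set S := Real.sinh Ω
  have h1 : z ^ 2 / 2 ≤ z ^ 2 / 2 * X := le_mul_of_one_le_right (by positivity) hX
  have h2 : w * C ≤ w * (X * C) :=
    mul_le_mul_of_nonneg_left (le_mul_of_one_le_left hC.le hX) hw.le
  have h3 : S ^ 2 ≤ (Real.cosh R + 1) * (C - 1) := by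
    rw [hS]
    nlinarith [mul_nonneg (sub_nonneg.2 hC1) (sub_nonneg.2 hR)]
  have h4 : -(z ^ 2 + S ^ 2) / 2 ≤ z * S := by nlinarith [sq_nonneg (z + S)]
  have h5 := mul_le_mul_of_nonneg_left h4 hε.le
  have h6 := mul_le_mul_of_nonneg_left h3 hε.le
  have h7 : ε * ((Real.cosh R + 1) * (C - 1)) ≤ w * (C - 1) := by
    rw [← mul_assoc]; exact mul_le_mul_of_nonneg_right hε₂ (sub_nonneg.2 hC1)
  have h8 : ε * z ^ 2 ≤ 1 / 2 * z ^ 2 := mul_le_mul_of_nonneg_right hε₁ (sq_nonneg z)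
  have h9 := mul_le_mul_of_nonneg_left hC2 hw.le
  nlinarith

/-- The right side is the quadratic quantity in which dissipation is measured, so this comparison
turns dissipation into an exponential rate. -/
theorem strictEnergy_le {n w ε R Ω z : ℝ} (hn : 0 ≤ n) (hw : 0 < w) (hε : 0 < ε)
    (hε₁ : ε ≤ 1 / 2) (hΩ : |Ω| ≤ R) :
    strictEnergy n w ε Ω z ≤ (Real.cosh R ^ n + w * ((n + 1) * Real.cosh R ^ (n + 1)) + 1) *
      (z ^ 2 + Real.sinh Ω ^ 2) := by
  have hR : Real.cosh Ω ≤ Real.cosh R := Real.cosh_le_cosh.2 (hΩ.trans (le_abs_self R))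
  have hC := Real.cosh_pos Ω
  have hC1 := Real.one_le_cosh Ω
  have hS := Real.sinh_sq Ω
  have hX : Real.cosh Ω ^ n ≤ Real.cosh R ^ n := Real.rpow_le_rpow hC.le hR hn
  have hX' : Real.cosh Ω ^ (n + 1) ≤ Real.cosh R ^ (n + 1) :=
    Real.rpow_le_rpow hC.le hR (by linarith)
  have hXR : 0 < Real.cosh R ^ n := Real.rpow_pos_of_pos (Real.cosh_pos _) _
  have hXR' : 0 < Real.cosh R ^ (n + 1) := Real.rpow_pos_of_pos (Real.cosh_pos _) _
  have h1 := rpow_sub_one_le_mul_sub_one hC1 (show 1 ≤ n + 1 by linarith)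
  unfold strictEnergy pendulumEnergy
  set C := Real.cosh Ω
  set S := Real.sinh Ω
  have h2 : C - 1 ≤ S ^ 2 := by rw [hS]; nlinarith
  have h3 : C ^ (n + 1) - 1 ≤ (n + 1) * Real.cosh R ^ (n + 1) * S ^ 2 := by
    refine h1.trans ?_
    gcongr
  have h4 : z ^ 2 / 2 * C ^ n ≤ z ^ 2 * Real.cosh R ^ n := by
    have := mul_le_mul_of_nonneg_left hX (show 0 ≤ z ^ 2 / 2 by positivity)
    have h' : 0 ≤ z ^ 2 * Real.cosh R ^ n := by positivity
    linarith
  have h5 : ε * (z * S) ≤ z ^ 2 + S ^ 2 := by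
    have h' : z * S ≤ (z ^ 2 + S ^ 2) / 2 := by nlinarith [sq_nonneg (z - S)]
    have := mul_le_mul_of_nonneg_left h' hε.le
    nlinarith [sq_nonneg z, sq_nonneg S]
  have h6 := mul_le_mul_of_nonneg_left h3 hw.le
  have h7 : 0 ≤ Real.cosh R ^ n * S ^ 2 := by positivity
  have h8 : 0 ≤ w * ((n + 1) * Real.cosh R ^ (n + 1)) * z ^ 2 := by
    have : 0 ≤ n + 1 := by linarith
    positivity
  linarith

/-- Unlike `energyRate_mul_le`, this keeps the damping, at the price of a constant depending on the
bounded set. -/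
theorem exists_energyRate_le {d₁ d₂ d₃ : ℝ} (hd₁ : 0 < d₁) (hd₂ : 0 < d₂) (hd₃ : 0 < d₃) (R E : ℝ) :
    ∃ k, 0 ≤ k ∧ ∀ Ω z q f e : ℝ, |Ω| ≤ R → |z| ≤ R → |q| ≤ e → |f| ≤ e → e ≤ E →
      Real.cosh Ω ^ (2 * d₃) * energyRate d₁ d₂ d₃ Ω z q f ≤ -d₁ * z ^ 2 + k * e := by
  refine ⟨Real.cosh R ^ (2 * d₃) * (d₁ * |R| + d₃ * |R| * (|R| + |E|) + |R| + d₂ * Real.cosh R),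
    by have := Real.rpow_pos_of_pos (Real.cosh_pos R) (2 * d₃)
       have := Real.cosh_pos R
       positivity, fun Ω z q f e hΩ hz hq hf heE => ?_⟩
  have hR : Real.cosh Ω ≤ Real.cosh R := Real.cosh_le_cosh.2 (hΩ.trans (le_abs_self R))
  have he : 0 ≤ e := (abs_nonneg _).trans hq
  have hC := Real.cosh_pos Ω
  have hC1 := Real.one_le_cosh Ω
  have hS := (abs_sinh_le_cosh Ω).trans hR
  have hT : |Real.sinh Ω / Real.cosh Ω| ≤ 1 := by
    rw [abs_div, abs_of_pos hC]; exact div_le_one_of_le₀ (abs_sinh_le_cosh Ω) hC.le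
  have hX : Real.cosh Ω ^ (2 * d₃) ≤ Real.cosh R ^ (2 * d₃) :=
    Real.rpow_le_rpow hC.le hR (by linarith)
  have hX1 : 1 ≤ Real.cosh Ω ^ (2 * d₃) := Real.one_le_rpow hC1 (by linarith)
  have hz' := hz.trans (le_abs_self R)
  have heE' := heE.trans (le_abs_self E)
  unfold energyRate
  set T := Real.sinh Ω / Real.cosh Ω
  set S := Real.sinh Ω
  set X := Real.cosh Ω ^ (2 * d₃)
  have t2 : -(d₁ * z * q) ≤ d₁ * |R| * e := by
    refine (neg_le_abs _).trans ?_
    rw [abs_mul, abs_mul, abs_of_pos hd₁]; gcongr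
  have t3 : -(d₃ * z * T * (z + q) * q) ≤ d₃ * |R| * 1 * (|R| + |E|) * e := by
    refine (neg_le_abs _).trans ?_
    rw [abs_mul, abs_mul, abs_mul, abs_mul, abs_of_pos hd₃]
    have := (abs_add_le z q).trans (add_le_add hz' (hq.trans heE'))
    gcongr
  have t4 : z * f ≤ |R| * e := by
    refine (le_abs_self _).trans ?_
    rw [abs_mul]; gcongr
  have t5 : d₂ * S * q ≤ d₂ * Real.cosh R * e := by
    refine (le_abs_self _).trans ?_
    rw [abs_mul, abs_mul, abs_of_pos hd₂]; gcongr
  have hsum : -(d₁ * z * q) - d₃ * z * T * (z + q) * q + z * f + d₂ * S * q ≤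
      (d₁ * |R| + d₃ * |R| * (|R| + |E|) + |R| + d₂ * Real.cosh R) * e := by linarith
  have hB : 0 ≤ (d₁ * |R| + d₃ * |R| * (|R| + |E|) + |R| + d₂ * Real.cosh R) * e := by
    have := Real.cosh_pos R
    positivity
  have h1 := mul_le_mul_of_nonneg_left hsum (zero_le_one.trans hX1)
  have h2 := mul_le_mul_of_nonneg_right hX hB
  have h3 : d₁ * z ^ 2 ≤ X * (d₁ * z ^ 2) := le_mul_of_one_le_left (by positivity) hX1
  linarith

/-- The derivative of `z sinh Ω` supplies the dissipation in `Ω` that the energy lacks. The mixed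
term `d₁ z sinh Ω` is split by completing a square, and the leading `d₃` term has the good sign. -/
theorem exists_pendulumForce_mul_sinh_le {d₁ d₂ d₃ : ℝ} (hd₁ : 0 < d₁) (hd₂ : 0 < d₂)
    (hd₃ : 0 < d₃) (R E : ℝ) :
    ∃ k, 0 ≤ k ∧ ∀ Ω z q f e : ℝ, |Ω| ≤ R → |z| ≤ R → |q| ≤ e → |f| ≤ e → e ≤ E →
      pendulumForce d₁ d₂ d₃ Ω (z + q) f * Real.sinh Ω + z * (Real.cosh Ω * (z + q)) ≤
        -(d₂ / 2) * Real.sinh Ω ^ 2 + (d₁ ^ 2 / (2 * d₂) + Real.cosh R) * z ^ 2 + k * e := by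
  refine ⟨d₁ * Real.cosh R + d₃ * (2 * |R| + |E|) * Real.cosh R + Real.cosh R + |R| * Real.cosh R,
    by have := Real.cosh_pos R
       positivity, fun Ω z q f e hΩ hz hq hf heE => ?_⟩
  have hR : Real.cosh Ω ≤ Real.cosh R := Real.cosh_le_cosh.2 (hΩ.trans (le_abs_self R))
  have he : 0 ≤ e := (abs_nonneg _).trans hq
  have hC := Real.cosh_pos Ω
  have hCR := Real.cosh_pos R
  have hS := (abs_sinh_le_cosh Ω).trans hR
  have hT : |Real.sinh Ω / Real.cosh Ω| ≤ 1 := by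
    rw [abs_div, abs_of_pos hC]; exact div_le_one_of_le₀ (abs_sinh_le_cosh Ω) hC.le
  have hTS : 0 ≤ Real.sinh Ω / Real.cosh Ω * Real.sinh Ω := by
    rw [div_mul_eq_mul_div, ← sq]; positivity
  have hz' := hz.trans (le_abs_self R)
  have heE' := heE.trans (le_abs_self E)
  unfold pendulumForce
  set T := Real.sinh Ω / Real.cosh Ω
  set S := Real.sinh Ω
  set C := Real.cosh Ω
  have t1 : -(d₁ * S * q) ≤ d₁ * Real.cosh R * e := by
    refine (neg_le_abs _).trans ?_
    rw [abs_mul, abs_mul, abs_of_pos hd₁]; gcongr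
  have t2 : -(d₃ * (2 * z + q) * T * S * q) ≤ d₃ * (2 * |R| + |E|) * 1 * Real.cosh R * e := by
    refine (neg_le_abs _).trans ?_
    rw [abs_mul, abs_mul, abs_mul, abs_mul, abs_of_pos hd₃]
    have : |2 * z + q| ≤ 2 * |R| + |E| := by
      refine (abs_add_le _ _).trans (add_le_add ?_ (hq.trans heE'))
      rw [abs_mul, abs_two]; linarith
    gcongr
  have t3 : S * f ≤ Real.cosh R * e := by
    refine (le_abs_self _).trans ?_
    rw [abs_mul]; gcongr
  have t4 : z * C * q ≤ |R| * Real.cosh R * e := by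
    refine (le_abs_self _).trans ?_
    rw [abs_mul, abs_mul, abs_of_pos hC]; gcongr
  have t5 : -(d₁ * z * S) ≤ d₂ / 2 * S ^ 2 + d₁ ^ 2 / (2 * d₂) * z ^ 2 := by
    have : d₂ / 2 * S ^ 2 + d₁ ^ 2 / (2 * d₂) * z ^ 2 + d₁ * z * S
        = (d₂ * S + d₁ * z) ^ 2 / (2 * d₂) := by field_simp; ring
    have h' : 0 ≤ (d₂ * S + d₁ * z) ^ 2 / (2 * d₂) := by positivity
    linarith
  have t6 : z ^ 2 * C ≤ Real.cosh R * z ^ 2 := by nlinarith [mul_le_mul_of_nonneg_left hR (sq_nonneg z)]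
  have t7 : 0 ≤ d₃ * z ^ 2 * (T * S) := by positivity
  linarith

theorem exists_strictEnergy_rate_le {d₁ d₂ d₃ w : ℝ} (hd₁ : 0 < d₁) (hd₂ : 0 < d₂) (hd₃ : 0 < d₃)
    (hw : 0 < w) (R E : ℝ) :
    ∃ ε c m k : ℝ, 0 < c ∧ 0 < m ∧ 0 ≤ k ∧ ∀ Ω z q f e : ℝ, |Ω| ≤ R → |z| ≤ R → |q| ≤ e → |f| ≤ e →
      e ≤ E → m * Ω ^ 2 ≤ strictEnergy (2 * d₃) w ε Ω z ∧ m * z ^ 2 ≤ strictEnergy (2 * d₃) w ε Ω z ∧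
      Real.cosh Ω ^ (2 * d₃) * energyRate d₁ d₂ d₃ Ω z q f
        + ε * (pendulumForce d₁ d₂ d₃ Ω (z + q) f * Real.sinh Ω
          + z * (Real.cosh Ω * (z + q))) ≤ -c * strictEnergy (2 * d₃) w ε Ω z + k * e := by
  obtain ⟨k₁, hk₁, h₁⟩ := exists_energyRate_le hd₁ hd₂ hd₃ R E
  obtain ⟨k₂, hk₂, h₂⟩ := exists_pendulumForce_mul_sinh_le hd₁ hd₂ hd₃ R E
  have hCR := Real.cosh_pos R
  set Q := d₁ ^ 2 / (2 * d₂) + Real.cosh R with hQ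
  have hQ0 : 0 < Q := by positivity
  -- The first two bounds keep the function positive definite; the third limits the `z²` produced by
  -- the cross term to half of the damping.
  set ε := min (1 / 2) (min (w / (Real.cosh R + 1)) (d₁ / (2 * Q))) with hε
  have hε0 : 0 < ε := by positivity
  have hε₁ : ε ≤ 1 / 2 := min_le_left _ _
  have hε₂ : ε * (Real.cosh R + 1) ≤ w := by
    rw [← le_div_iff₀ (by positivity)]
    exact (min_le_right _ _).trans (min_le_left _ _)
  have hε₃ : ε * Q ≤ d₁ / 2 := by
    have : ε ≤ d₁ / (2 * Q) := (min_le_right _ _).trans (min_le_right _ _)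
    rw [le_div_iff₀ (by positivity)] at this
    linarith
  set K := Real.cosh R ^ (2 * d₃) + w * ((2 * d₃ + 1) * Real.cosh R ^ (2 * d₃ + 1)) + 1 with hK
  have hK0 : 0 < K := by
    have := Real.rpow_pos_of_pos hCR (2 * d₃)
    have := Real.rpow_pos_of_pos hCR (2 * d₃ + 1)
    positivity
  set b := min (d₁ / 2) (ε * (d₂ / 2)) with hb
  have hb0 : 0 < b := by positivity
  refine ⟨ε, b / K, min (1 / 4) (w / 4), k₁ + ε * k₂, by positivity, by positivity, by positivity,
    fun Ω z q f e hΩ hz hq hf he => ⟨?_, ?_, ?_⟩⟩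
  · have h := le_strictEnergy (z := z) (by positivity : 0 ≤ 2 * d₃) hw hε0 hε₁ hε₂ hΩ
    nlinarith [mul_le_mul_of_nonneg_right (min_le_right (1 / 4) (w / 4)) (sq_nonneg Ω), sq_nonneg z]
  · have h := le_strictEnergy (z := z) (by positivity : 0 ≤ 2 * d₃) hw hε0 hε₁ hε₂ hΩ
    nlinarith [mul_le_mul_of_nonneg_right (min_le_left (1 / 4) (w / 4)) (sq_nonneg z),
      mul_nonneg hw.le (sq_nonneg Ω)]
  · have a1 := h₁ Ω z q f e hΩ hz hq hf he
    have a2 := mul_le_mul_of_nonneg_left (h₂ Ω z q f e hΩ hz hq hf he) hε0.le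
    have a3 := strictEnergy_le (z := z) (by positivity : 0 ≤ 2 * d₃) hw hε0 hε₁ hΩ
    rw [← hK] at a3
    have a4 : b / K * strictEnergy (2 * d₃) w ε Ω z ≤ b * (z ^ 2 + Real.sinh Ω ^ 2) := by
      rw [div_mul_eq_mul_div, div_le_iff₀ hK0]
      calc _ ≤ b * (K * (z ^ 2 + Real.sinh Ω ^ 2)) := by gcongr
        _ = _ := by ring
    have a5 : b * z ^ 2 ≤ d₁ / 2 * z ^ 2 := by gcongr; exact min_le_left _ _
    have a6 : b * Real.sinh Ω ^ 2 ≤ ε * (d₂ / 2) * Real.sinh Ω ^ 2 := by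
      gcongr; exact min_le_right _ _
    have a7 : ε * Q * z ^ 2 ≤ d₁ / 2 * z ^ 2 := by gcongr
    linarith

/-- A perturbed pendulum whose motion is bounded and whose perturbation decays exponentially
comes to rest at the origin. -/
theorem tendsto_zero_of_perturbed_pendulum {d₁ d₂ d₃ R k μ t₀ : ℝ} {Ω z q f : ℝ → ℝ}
    (hd₁ : 0 < d₁) (hd₂ : 0 < d₂) (hd₃ : 0 < d₃) (hμ : 0 < μ)
    (hΩd : ∀ b, ∀ t ∈ Icc t₀ b, HasDerivWithinAt Ω (z t + q t) (Icc t₀ b) t)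
    (hzd : ∀ b, ∀ t ∈ Icc t₀ b,
      HasDerivWithinAt z (pendulumForce d₁ d₂ d₃ (Ω t) (z t + q t) (f t)) (Icc t₀ b) t)
    (hΩ : ∀ t, t₀ ≤ t → |Ω t| ≤ R) (hz : ∀ t, t₀ ≤ t → |z t| ≤ R)
    (hq : ∀ t, t₀ ≤ t → |q t| ≤ k * Real.exp (-μ * (t - t₀)))
    (hf : ∀ t, t₀ ≤ t → |f t| ≤ k * Real.exp (-μ * (t - t₀))) :
    Tendsto Ω atTop (𝓝 0) ∧ Tendsto z atTop (𝓝 0) := by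
  have hw : d₂ / (2 * d₃ + 1) * (2 * d₃ + 1) = d₂ := div_mul_cancel₀ _ (by positivity)
  have hw0 : 0 < d₂ / (2 * d₃ + 1) := by positivity
  have hk : 0 ≤ k := by simpa using (abs_nonneg _).trans (hq t₀ le_rfl)
  set w := d₂ / (2 * d₃ + 1)
  obtain ⟨ε, c, m, k', hc, hm, hk', H⟩ := exists_strictEnergy_rate_le hd₁ hd₂ hd₃ hw0 R k
  have hexp : ∀ t, t₀ ≤ t → k * Real.exp (-μ * (t - t₀)) ≤ k := fun t ht =>
    mul_le_of_le_one_right hk (Real.exp_le_one_iff.2 (by nlinarith))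
  -- The decay lemma needs a forcing rate strictly below `c`, so the forcing is compared with a
  -- slower exponential.
  set ν := min μ (c / 2) with hν
  have hν0 : 0 < ν := by positivity
  have hνc : ν < c := (min_le_right _ _).trans_lt (by linarith)
  set Y := fun t => strictEnergy (2 * d₃) w ε (Ω t) (z t) with hY
  have hYle : ∀ b, t₀ ≤ b → Y b ≤ (|Y t₀| + k' * k / (c - ν)) * Real.exp (-ν * (b - t₀)) := by
    intro b hb
    refine le_mul_exp_of_hasDerivWithinAt_le hb hνc (by positivity)
      (fun t ht => hasDerivWithinAt_strictEnergy hw (hΩd b t ht) (hzd b t ht)) (fun t ht => ?_)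
    refine (H (Ω t) (z t) (q t) (f t) _ (hΩ t ht.1) (hz t ht.1) (hq t ht.1) (hf t ht.1)
      (hexp t ht.1)).2.2.trans ?_
    rw [mul_assoc]
    gcongr
    · linarith [ht.1]
    · exact min_le_left _ _
  have hlim : Tendsto (fun b => (|Y t₀| + k' * k / (c - ν)) * Real.exp (-ν * (b - t₀)) / m)
      atTop (𝓝 0) := by
    have h1 : Tendsto (fun b : ℝ => ν * (b - t₀)) atTop atTop :=
      (tendsto_atTop_add_const_right _ (-t₀) tendsto_id).const_mul_atTop hν0
    have h2 := ((Real.tendsto_exp_neg_atTop_nhds_zero.comp h1).const_mul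
      (|Y t₀| + k' * k / (c - ν))).div_const m
    simpa [Function.comp_def] using h2
  have hsq : ∀ g : ℝ → ℝ, (∀ t, t₀ ≤ t → m * g t ^ 2 ≤ Y t) → Tendsto g atTop (𝓝 0) := by
    intro g hg
    have h1 : Tendsto (fun t => g t ^ 2) atTop (𝓝 0) := by
      refine squeeze_zero' (Eventually.of_forall fun t => sq_nonneg _) ?_ hlim
      filter_upwards [eventually_ge_atTop t₀] with t ht
      rw [le_div_iff₀ hm]
      linarith [hg t ht, hYle t ht]
    have h2 := h1.sqrt
    simp only [Real.sqrt_sq_eq_abs, Real.sqrt_zero] at h2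
    exact (tendsto_zero_iff_abs_tendsto_zero g).2 h2
  exact ⟨hsq Ω fun t ht => (H _ _ _ _ _ (hΩ t ht) (hz t ht) (hq t ht) (hf t ht) (hexp t ht)).1,
    hsq z fun t ht => (H _ _ _ _ _ (hΩ t ht) (hz t ht) (hq t ht) (hf t ht) (hexp t ht)).2.1⟩

/-- The energy has minimum `w`, taken at rest, and its excess over `w` controls the state. -/
theorem pendulumEnergy_sub_ge {n w Ω z : ℝ} (hn : 0 ≤ n) (hw : 0 < w) :
    z ^ 2 / 2 + w * (Ω ^ 2 / 2) ≤ pendulumEnergy n w Ω z - w := by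
  have hC := Real.cosh_pos Ω
  have hC1 := Real.one_le_cosh Ω
  have hX : 1 ≤ Real.cosh Ω ^ n := Real.one_le_rpow hC1 hn
  unfold pendulumEnergy
  rw [Real.rpow_add_one hC.ne']
  have h1 : z ^ 2 / 2 ≤ z ^ 2 / 2 * Real.cosh Ω ^ n := le_mul_of_one_le_right (by positivity) hX
  have h2 : w * Real.cosh Ω ≤ w * (Real.cosh Ω ^ n * Real.cosh Ω) :=
    mul_le_mul_of_nonneg_left (le_mul_of_one_le_left hC.le hX) hw.le
  have h3 := mul_le_mul_of_nonneg_left (one_add_sq_div_two_le_cosh Ω) hw.le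
  linarith

theorem pendulumEnergy_le {n w Ω z r r' : ℝ} (hn : 0 ≤ n) (hw : 0 < w) (hΩ : |Ω| ≤ r)
    (hz : |z| ≤ r') : pendulumEnergy n w Ω z ≤ pendulumEnergy n w r r' := by
  have hC := Real.cosh_pos Ω
  have hR : Real.cosh Ω ≤ Real.cosh r := Real.cosh_le_cosh.2 (hΩ.trans (le_abs_self r))
  have hz' : z ^ 2 ≤ r' ^ 2 := sq_le_sq.2 (hz.trans (le_abs_self r'))
  unfold pendulumEnergy
  gcongr

theorem abs_le_of_pendulumEnergy_le {n w Ω z B : ℝ} (hn : 0 ≤ n) (hw : 0 < w)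
    (h : pendulumEnergy n w Ω z ≤ B) :
    |Ω| ≤ √(2 * (B - w) / w) ∧ |z| ≤ √(2 * (B - w)) := by
  have h1 := pendulumEnergy_sub_ge (Ω := Ω) (z := z) hn hw
  have h2 : 0 ≤ w * (Ω ^ 2 / 2) := by positivity
  have h3 : 0 ≤ z ^ 2 / 2 := by positivity
  constructor
  · refine Real.abs_le_sqrt ?_
    rw [le_div_iff₀ hw]
    linarith
  · exact Real.abs_le_sqrt (by linarith)

/-! ### The reduced system: regularity, a priori bounds, existence, convergence. -/

namespace CartPendulum

/-- `angle` is the Gudermannian function; it turns the trigonometric terms of the motion into the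
hyperbolic ones of `pendulumForce`. -/
theorem cos_angle (Ω : ℝ) : Real.cos (angle Ω) = 1 / Real.cosh Ω := by
  have h : angle Ω = Real.pi / 2 - 2 * Real.arctan (Real.exp (-Ω)) := by unfold angle; ring
  rw [h, Real.cos_pi_div_two_sub, Real.sin_two_mul, Real.sin_arctan, Real.cos_arctan,
    Real.cosh_eq, Real.exp_neg]
  have he := Real.exp_pos Ω
  have h1 : 0 < 1 + (Real.exp Ω)⁻¹ ^ 2 := by positivity
  have h2 := Real.sq_sqrt h1.le
  have h3 : 0 < √(1 + (Real.exp Ω)⁻¹ ^ 2) := Real.sqrt_pos.2 h1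
  field_simp at h2 ⊢
  rw [h2]

theorem sin_angle (Ω : ℝ) : Real.sin (angle Ω) = Real.sinh Ω / Real.cosh Ω := by
  have h : angle Ω = Real.pi / 2 - 2 * Real.arctan (Real.exp (-Ω)) := by unfold angle; ring
  rw [h, Real.sin_pi_div_two_sub, Real.cos_two_mul, Real.cos_sq_arctan,
    Real.cosh_eq, Real.sinh_eq, Real.exp_neg]
  have he := Real.exp_pos Ω
  field_simp
  ring

theorem tan_angle (Ω : ℝ) : Real.tan (angle Ω) = Real.sinh Ω := by
  rw [Real.tan_eq_sin_div_cos, sin_angle, cos_angle]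
  have := Real.cosh_pos Ω
  field_simp

variable (p : CartPendulum)

/-- The sign conditions on the derived constants under which the closed loop is stable. -/
structure Admissible : Prop where
  L_pos : 0 < p.L
  L_sq_lt : p.L ^ 2 < p.M * p.I
  I_lt : p.I < p.ρ * p.L
  a_pos : 0 < p.a
  α_pos : 0 < p.α
  d₁_pos : 0 < p.d₁
  d₂_pos : 0 < p.d₂
  d₃_pos : 0 < p.d₃

/-- The coefficient of `d/dt (γ / ψ)` in the equation for `Ω''`. -/
noncomputable def coupling : ℝ := p.L / (p.ρ * p.L - p.I)

/-- The weight of the potential energy. -/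
noncomputable def weight : ℝ := p.d₂ / (2 * p.d₃ + 1)

/-- The vector field for `(s, Ω, z)`, where `z = Ω' - (L / (ρ L - I)) γ / ψ`. It contains neither
the relay nor the disturbance. -/
noncomputable def reducedField (σ γ : ℝ) (y : ℝ × ℝ × ℝ) : ℝ × ℝ × ℝ :=
  (γ / p.psi (angle y.2.1) - p.α * y.1,
    y.2.2 + p.coupling * (γ / p.psi (angle y.2.1)),
    pendulumForce p.d₁ p.d₂ p.d₃ y.2.1 (y.2.2 + p.coupling * (γ / p.psi (angle y.2.1)))
      (σ * (γ / p.psi (angle y.2.1) - p.α * y.1)))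

/-- `y` solves the reduced system driven by `γ` on `[t₀, b]`. -/
def IsReducedSolution (σ : ℝ) (γ : ℝ → ℝ) (y : ℝ → ℝ × ℝ × ℝ) (t₀ b : ℝ) : Prop :=
  ∀ t ∈ Icc t₀ b, HasDerivWithinAt y (p.reducedField σ (γ t) (y t)) (Icc t₀ b) t

variable {p}

theorem psi_angle (Ω : ℝ) : p.psi (angle Ω) = p.M * p.I - p.L ^ 2 / Real.cosh Ω ^ 2 := by
  rw [psi, cos_angle]; ring

theorem sub_le_psi (β : ℝ) : p.M * p.I - p.L ^ 2 ≤ p.psi β := by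
  have := mul_le_mul_of_nonneg_left (Real.cos_sq_le_one β) (sq_nonneg p.L)
  unfold psi
  linarith

namespace Admissible

variable (hp : p.Admissible)
include hp

theorem psi_pos (β : ℝ) : 0 < p.psi β := (sub_pos.2 hp.L_sq_lt).trans_le (sub_le_psi β)

theorem coupling_pos : 0 < p.coupling := div_pos hp.L_pos (sub_pos.2 hp.I_lt)

theorem weight_pos : 0 < p.weight :=
  div_pos hp.d₂_pos (by linarith [hp.d₃_pos])

theorem weight_mul : p.weight * (2 * p.d₃ + 1) = p.d₂ :=
  div_mul_cancel₀ _ (by linarith [hp.d₃_pos])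

theorem abs_div_psi_le (γ β : ℝ) : |γ / p.psi β| ≤ |γ| / (p.M * p.I - p.L ^ 2) := by
  rw [abs_div, abs_of_pos (hp.psi_pos β)]
  exact div_le_div_of_nonneg_left (abs_nonneg _) (sub_pos.2 hp.L_sq_lt) (sub_le_psi β)

end Admissible

theorem contDiff_psi_angle : ContDiff ℝ 1 fun Ω => p.psi (angle Ω) := by
  simp_rw [psi_angle]
  exact contDiff_const.sub (contDiff_const.div (Real.contDiff_cosh.pow 2)
    fun Ω => (pow_pos (Real.cosh_pos Ω) 2).ne')

theorem Admissible.contDiff_reducedField (hp : p.Admissible) (σ : ℝ) :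
    ContDiff ℝ 1 fun u : ℝ × ℝ × ℝ × ℝ => p.reducedField σ u.1 u.2 := by
  have hψ : ContDiff ℝ 1 fun u : ℝ × ℝ × ℝ × ℝ => u.1 / p.psi (angle u.2.2.1) :=
    contDiff_fst.div (contDiff_psi_angle.comp (g := fun Ω => p.psi (angle Ω)) (by fun_prop))
      fun u => (hp.psi_pos _).ne'
  have hT : ContDiff ℝ 1 fun u : ℝ × ℝ × ℝ × ℝ => Real.sinh u.2.2.1 / Real.cosh u.2.2.1 :=
    ContDiff.div (by fun_prop) (by fun_prop) fun u => (Real.cosh_pos _).ne'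
  unfold reducedField pendulumForce
  fun_prop

theorem Admissible.exists_lipschitzOnWith_reducedField (hp : p.Admissible) (σ R : ℝ) :
    ∃ K : NNReal, ∀ γ : ℝ, |γ| ≤ R →
      LipschitzOnWith K (p.reducedField σ γ) (Metric.closedBall 0 R) := by
  obtain ⟨K, hK⟩ := (hp.contDiff_reducedField σ).contDiffOn.exists_lipschitzOnWith
    (s := Metric.closedBall (0 : ℝ × ℝ × ℝ × ℝ) R) one_ne_zero (convex_closedBall _ _)
    (isCompact_closedBall _ _)
  refine ⟨K, fun γ hγ => LipschitzOnWith.of_dist_le_mul fun y hy y' hy' => ?_⟩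
  have hmem : ∀ y : ℝ × ℝ × ℝ, y ∈ Metric.closedBall 0 R →
      (γ, y) ∈ Metric.closedBall (0 : ℝ × ℝ × ℝ × ℝ) R := fun y hy => by
    rw [mem_closedBall_zero_iff] at hy ⊢
    exact max_le hγ hy
  have := hK.dist_le_mul _ (hmem y hy) _ (hmem y' hy')
  rwa [dist_prod_same_left] at this

theorem Admissible.exists_norm_reducedField_le (hp : p.Admissible) (σ R : ℝ) :
    ∃ B : NNReal, ∀ γ : ℝ, |γ| ≤ R → ∀ y ∈ Metric.closedBall (0 : ℝ × ℝ × ℝ) R,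
      ‖p.reducedField σ γ y‖ ≤ B := by
  obtain ⟨B, hB⟩ := (isCompact_closedBall (0 : ℝ × ℝ × ℝ × ℝ) R).exists_bound_of_continuousOn
    (hp.contDiff_reducedField σ).continuous.continuousOn
  refine ⟨B.toNNReal, fun γ hγ y hy => (hB (γ, y) ?_).trans (Real.le_coe_toNNReal B)⟩
  rw [mem_closedBall_zero_iff] at hy ⊢
  exact max_le hγ hy

namespace IsReducedSolution

variable {σ t₀ b : ℝ} {γ : ℝ → ℝ} {y : ℝ → ℝ × ℝ × ℝ}

theorem mono {b' : ℝ} (h : p.IsReducedSolution σ γ y t₀ b) (hb : b' ≤ b) :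
    p.IsReducedSolution σ γ y t₀ b' := fun t ht =>
  (h t (Icc_subset_Icc_right hb ht)).mono (Icc_subset_Icc_right hb)

theorem continuousOn (h : p.IsReducedSolution σ γ y t₀ b) : ContinuousOn y (Icc t₀ b) :=
  fun t ht => (h t ht).continuousWithinAt

theorem hasDerivWithinAt_fst (h : p.IsReducedSolution σ γ y t₀ b) {t : ℝ} (ht : t ∈ Icc t₀ b) :
    HasDerivWithinAt (fun t => (y t).1) (p.reducedField σ (γ t) (y t)).1 (Icc t₀ b) t :=
  (ContinuousLinearMap.fst ℝ ℝ (ℝ × ℝ)).hasFDerivAt.comp_hasDerivWithinAt t (h t ht)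

theorem hasDerivWithinAt_snd_fst (h : p.IsReducedSolution σ γ y t₀ b) {t : ℝ}
    (ht : t ∈ Icc t₀ b) :
    HasDerivWithinAt (fun t => (y t).2.1) (p.reducedField σ (γ t) (y t)).2.1 (Icc t₀ b) t :=
  ((ContinuousLinearMap.fst ℝ ℝ ℝ).comp
    (ContinuousLinearMap.snd ℝ ℝ (ℝ × ℝ))).hasFDerivAt.comp_hasDerivWithinAt t (h t ht)

theorem hasDerivWithinAt_snd_snd (h : p.IsReducedSolution σ γ y t₀ b) {t : ℝ}
    (ht : t ∈ Icc t₀ b) :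
    HasDerivWithinAt (fun t => (y t).2.2) (p.reducedField σ (γ t) (y t)).2.2 (Icc t₀ b) t :=
  ((ContinuousLinearMap.snd ℝ ℝ ℝ).comp
    (ContinuousLinearMap.snd ℝ ℝ (ℝ × ℝ))).hasFDerivAt.comp_hasDerivWithinAt t (h t ht)

end IsReducedSolution

theorem Admissible.isReducedSolution_unique (hp : p.Admissible) {σ t₀ b : ℝ} {γ : ℝ → ℝ}
    {y₁ y₂ : ℝ → ℝ × ℝ × ℝ} (hγ : ContinuousOn γ (Icc t₀ b))
    (h₁ : p.IsReducedSolution σ γ y₁ t₀ b) (h₂ : p.IsReducedSolution σ γ y₂ t₀ b)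
    (h0 : y₁ t₀ = y₂ t₀) : EqOn y₁ y₂ (Icc t₀ b) := by
  obtain ⟨R₀, hR₀⟩ := isCompact_Icc.exists_bound_of_continuousOn hγ
  obtain ⟨R₁, hR₁⟩ := isCompact_Icc.exists_bound_of_continuousOn h₁.continuousOn
  obtain ⟨R₂, hR₂⟩ := isCompact_Icc.exists_bound_of_continuousOn h₂.continuousOn
  set R := max R₀ (max R₁ R₂)
  obtain ⟨K, hK⟩ := hp.exists_lipschitzOnWith_reducedField σ R
  have hd : ∀ y, p.IsReducedSolution σ γ y t₀ b → ∀ t ∈ Ico t₀ b,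
      HasDerivWithinAt y (p.reducedField σ (γ t) (y t)) (Ici t) t := fun y hy t ht =>
    (hy t (Ico_subset_Icc_self ht)).mono_of_mem_nhdsWithin (Icc_mem_nhdsGE_of_mem ht)
  refine ODE_solution_unique_of_mem_Icc_right (v := fun t => p.reducedField σ (γ t))
    (s := fun _ => Metric.closedBall 0 R) (K := K)
    (fun t ht => hK _ ((hR₀ t (Ico_subset_Icc_self ht)).trans (le_max_left _ _)))
    h₁.continuousOn (hd _ h₁) (fun t ht => ?_) h₂.continuousOn (hd _ h₂) (fun t ht => ?_) h0
  · rw [mem_closedBall_zero_iff]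
    exact (hR₁ t (Ico_subset_Icc_self ht)).trans ((le_max_left _ _).trans (le_max_right _ _))
  · rw [mem_closedBall_zero_iff]
    exact (hR₂ t (Ico_subset_Icc_self ht)).trans ((le_max_right _ _).trans (le_max_right _ _))

/-- A priori bounds for the reduced system. -/
theorem Admissible.exists_bounds (hp : p.Admissible) (σ : ℝ) :
    ∃ μ k K : ℝ, 0 < μ ∧ 0 ≤ k ∧ 0 ≤ K ∧ ∀ (r t₀ b : ℝ) (γ : ℝ → ℝ) (y : ℝ → ℝ × ℝ × ℝ), 0 ≤ r →
      (∀ t ∈ Icc t₀ b, |γ t| ≤ r * Real.exp (-p.a * (t - t₀))) → |(y t₀).1| ≤ r →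
      p.IsReducedSolution σ γ y t₀ b → ∀ t ∈ Icc t₀ b,
        |(y t).1| ≤ k * r * Real.exp (-μ * (t - t₀)) ∧
        |p.coupling * (γ t / p.psi (angle (y t).2.1))| ≤ k * r * Real.exp (-μ * (t - t₀)) ∧
        |σ * (γ t / p.psi (angle (y t).2.1) - p.α * (y t).1)| ≤
          k * r * Real.exp (-μ * (t - t₀)) ∧
        pendulumEnergy (2 * p.d₃) p.weight (y t).2.1 (y t).2.2 ≤
          pendulumEnergy (2 * p.d₃) p.weight (y t₀).2.1 (y t₀).2.2 * Real.exp (K * (r * (1 + r))) := by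
  have ha := hp.a_pos
  have hα := hp.α_pos
  have hg : 0 < p.M * p.I - p.L ^ 2 := sub_pos.2 hp.L_sq_lt
  have hP := hp.coupling_pos
  have hw := hp.weight_pos
  set g₀ := p.M * p.I - p.L ^ 2
  -- A common decay rate: at most `a`, for `γ`, and strictly below `α`, for the forced equation of
  -- `s`.
  set μ := min p.a p.α / 2 with hμdef
  have hμ : 0 < μ := by positivity
  have hμa : μ ≤ p.a := by
    have := min_le_left p.a p.α; linarith
  have hμα : μ < p.α := by
    have := min_le_right p.a p.α; linarith
  have hαμ : 0 < p.α - μ := sub_pos.2 hμα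
  -- The initial value contributes `1`; the forcing `γ / ψ`, of size `r / g₀`, contributes the
  -- quotient.
  set ks := 1 + 1 / g₀ / (p.α - μ) with hks
  have hks0 : 0 < ks := by positivity
  set k := ks + p.coupling / g₀ + |σ| * (1 / g₀ + p.α * ks) with hk
  have hk0 : 0 ≤ k := by positivity
  have hk₁ : ks ≤ k := by
    have : 0 ≤ p.coupling / g₀ := by positivity
    have : 0 ≤ |σ| * (1 / g₀ + p.α * ks) := by positivity
    linarith
  have hk₂ : p.coupling / g₀ ≤ k := by
    have : 0 ≤ |σ| * (1 / g₀ + p.α * ks) := by positivity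
    linarith
  have hk₃ : |σ| * (1 / g₀ + p.α * ks) ≤ k := by
    have : 0 ≤ p.coupling / g₀ := by positivity
    linarith
  set Kc := p.d₁ * (1 + 1 / p.weight) + 2 * p.d₃ + p.d₃ * (1 + 1 / p.weight) + (1 + 1 / p.weight)
    + p.d₂ / p.weight with hKc
  have hKc0 : 0 ≤ Kc := by
    have := hp.d₁_pos
    have := hp.d₂_pos
    have := hp.d₃_pos
    positivity
  refine ⟨μ, k, Kc * (k * (1 + k)) / μ, hμ, hk0, by positivity, ?_⟩
  intro r t₀ b γ y hr hγ hs₀ hy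
  have hγψ : ∀ t ∈ Icc t₀ b, |γ t / p.psi (angle (y t).2.1)| ≤
      r / g₀ * Real.exp (-μ * (t - t₀)) := by
    intro t ht
    refine (hp.abs_div_psi_le _ _).trans ?_
    rw [div_mul_eq_mul_div]
    refine div_le_div_of_nonneg_right ((hγ t ht).trans ?_) hg.le
    gcongr
    linarith [ht.1]
  have hs : ∀ t ∈ Icc t₀ b, |(y t).1| ≤ ks * r * Real.exp (-μ * (t - t₀)) := by
    intro t ht
    have hyt := hy.mono ht.2
    have hgen : ∀ S S' : ℝ → ℝ, |S t₀| ≤ r →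
        (∀ u ∈ Icc t₀ t, HasDerivWithinAt S (S' u) (Icc t₀ t) u) →
        (∀ u ∈ Icc t₀ t, S' u ≤ -p.α * S u + r / g₀ * Real.exp (-μ * (u - t₀))) →
        S t ≤ ks * r * Real.exp (-μ * (t - t₀)) := by
      intro S S' hS0 hS hS'
      refine (le_mul_exp_of_hasDerivWithinAt_le ht.1 hμα (by positivity) hS hS').trans ?_
      gcongr
      have : ks * r = r + r / g₀ / (p.α - μ) := by rw [hks]; ring
      linarith
    refine abs_le'.2 ⟨hgen (fun u => (y u).1) _ hs₀ (fun u hu => hyt.hasDerivWithinAt_fst hu)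
      fun u hu => ?_, hgen (fun u => -(y u).1) _ (by rwa [abs_neg])
      (fun u hu => (hyt.hasDerivWithinAt_fst hu).neg) fun u hu => ?_⟩
    · have := (abs_le.1 (hγψ u (Icc_subset_Icc_right ht.2 hu))).2
      simp only [reducedField]
      linarith
    · have := (abs_le.1 (hγψ u (Icc_subset_Icc_right ht.2 hu))).1
      simp only [reducedField]
      linarith
  have hq : ∀ t ∈ Icc t₀ b, |p.coupling * (γ t / p.psi (angle (y t).2.1))| ≤
      k * r * Real.exp (-μ * (t - t₀)) := by
    intro t ht
    rw [abs_mul, abs_of_pos hP]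
    calc _ ≤ p.coupling * (r / g₀ * Real.exp (-μ * (t - t₀))) := by gcongr; exact hγψ t ht
      _ = p.coupling / g₀ * r * Real.exp (-μ * (t - t₀)) := by ring
      _ ≤ _ := by gcongr
  have hf : ∀ t ∈ Icc t₀ b, |σ * (γ t / p.psi (angle (y t).2.1) - p.α * (y t).1)| ≤
      k * r * Real.exp (-μ * (t - t₀)) := by
    intro t ht
    rw [abs_mul]
    calc _ ≤ |σ| * (r / g₀ * Real.exp (-μ * (t - t₀)) +
          p.α * (ks * r * Real.exp (-μ * (t - t₀)))) := by
          gcongr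
          refine (abs_sub _ _).trans (add_le_add (hγψ t ht) ?_)
          rw [abs_mul, abs_of_pos hα]
          gcongr
          exact hs t ht
      _ = |σ| * (1 / g₀ + p.α * ks) * r * Real.exp (-μ * (t - t₀)) := by ring
      _ ≤ _ := by gcongr
  intro t ht
  refine ⟨(hs t ht).trans (by gcongr), hq t ht, hf t ht, ?_⟩
  have hyt := hy.mono ht.2
  have h1 := le_mul_exp_of_hasDerivWithinAt_le_mul (k := Kc * (k * r * (1 + k * r))) ht.1 hμ
    (by positivity) ?_
    (fun u hu => hasDerivWithinAt_pendulumEnergy hp.weight_mul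
      (hyt.hasDerivWithinAt_snd_fst hu) (hyt.hasDerivWithinAt_snd_snd hu)) ?_
  · refine h1.trans ?_
    have hE : 0 ≤ pendulumEnergy (2 * p.d₃) p.weight (y t₀).2.1 (y t₀).2.2 := by
      have := Real.cosh_pos (y t₀).2.1
      unfold pendulumEnergy; positivity
    have h2 : k * r * (1 + k * r) ≤ k * (1 + k) * (r * (1 + r)) := by
      have : 0 ≤ k * r * (k + r) := by positivity
      nlinarith
    have h3 : Kc * (k * r * (1 + k * r)) / μ ≤ Kc * (k * (1 + k)) / μ * (r * (1 + r)) := by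
      rw [div_mul_eq_mul_div, mul_assoc Kc]
      exact div_le_div_of_nonneg_right (mul_le_mul_of_nonneg_left h2 hKc0) hμ.le
    exact mul_le_mul_of_nonneg_left (Real.exp_le_exp.2 h3) hE
  · have := Real.cosh_pos (y t₀).2.1
    unfold pendulumEnergy; positivity
  · intro u hu
    have hu' := Icc_subset_Icc_right ht.2 hu
    have hE : 0 ≤ pendulumEnergy (2 * p.d₃) p.weight (y u).2.1 (y u).2.2 := by
      have := Real.cosh_pos (y u).2.1
      unfold pendulumEnergy; positivity
    refine (energyRate_mul_le hp.d₁_pos.le hp.d₂_pos.le hp.d₃_pos.le hw (hq u hu') (hf u hu')).trans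
      ?_
    rw [← hKc, mul_assoc Kc (k * r * (1 + k * r)), mul_assoc (k * r)]
    have hexp : Real.exp (-μ * (u - t₀)) ≤ 1 := Real.exp_le_one_iff.2 (by nlinarith [hu.1])
    have : k * r * (Real.exp (-μ * (u - t₀)) * (1 + k * r * Real.exp (-μ * (u - t₀)))) ≤
        k * r * ((1 + k * r) * Real.exp (-μ * (u - t₀))) := by
      rw [mul_comm (1 + k * r)]
      have : k * r * Real.exp (-μ * (u - t₀)) ≤ k * r :=
        mul_le_of_le_one_right (by positivity) hexp
      gcongr
    rw [mul_assoc (k * r)]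
    gcongr

/-- Solutions of the reduced system driven by a decaying signal exist for all later times. -/
theorem Admissible.exists_isReducedSolution (hp : p.Admissible) (σ : ℝ) {t₀ r : ℝ} {γ : ℝ → ℝ}
    (hγc : Continuous γ) (hr : 0 ≤ r) (hγ : ∀ t, t₀ ≤ t → |γ t| ≤ r * Real.exp (-p.a * (t - t₀)))
    (y₀ : ℝ × ℝ × ℝ) :
    ∃ y : ℝ → ℝ × ℝ × ℝ, y t₀ = y₀ ∧ ∀ b, p.IsReducedSolution σ γ y t₀ b := by
  obtain ⟨μ, k, K, hμ, hk, hK, hbd⟩ := hp.exists_bounds σ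
  have hn : 0 ≤ 2 * p.d₃ := by linarith [hp.d₃_pos]
  have hw := hp.weight_pos
  set r₁ := max r |y₀.1|
  have hr₁ : 0 ≤ r₁ := hr.trans (le_max_left _ _)
  have hγ₁ : ∀ t, t₀ ≤ t → |γ t| ≤ r₁ * Real.exp (-p.a * (t - t₀)) := fun t ht =>
    (hγ t ht).trans (by gcongr; exact le_max_left _ _)
  have hγr : ∀ t, t₀ ≤ t → |γ t| ≤ r₁ := fun t ht =>
    (hγ₁ t ht).trans (mul_le_of_le_one_right hr₁
      (Real.exp_le_one_iff.2 (by nlinarith [hp.a_pos])))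
  set B := pendulumEnergy (2 * p.d₃) p.weight y₀.2.1 y₀.2.2 * Real.exp (K * (r₁ * (1 + r₁)))
  -- A bound for every reduced solution from `y₀`, independent of how long it lasts.
  set M := max (k * r₁) (max √(2 * (B - p.weight) / p.weight) √(2 * (B - p.weight)))
  have hM : ∀ (b : ℝ) (y : ℝ → ℝ × ℝ × ℝ), t₀ ≤ b → y t₀ = y₀ → p.IsReducedSolution σ γ y t₀ b →
      ‖y b‖ ≤ M := by
    intro b y hb h0 hy
    obtain ⟨h1, -, -, h2⟩ := hbd r₁ t₀ b γ y hr₁ (fun t ht => hγ₁ t ht.1)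
      (by rw [h0]; exact le_max_right _ _) hy b (right_mem_Icc.2 hb)
    rw [h0] at h2
    obtain ⟨h3, h4⟩ := abs_le_of_pendulumEnergy_le hn hw h2
    refine max_le_max (h1.trans (mul_le_of_le_one_right (by positivity)
      (Real.exp_le_one_iff.2 (by nlinarith)))) (max_le_max h3 h4)
  set R := max M (max ‖y₀‖ r₁) + 1
  have hMR : M < R := by have := le_max_left M (max ‖y₀‖ r₁); linarith
  have hyR : ‖y₀‖ < R := by
    have := (le_max_left ‖y₀‖ r₁).trans (le_max_right M (max ‖y₀‖ r₁)); linarith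
  have hrR : r₁ ≤ R := by
    have := (le_max_right ‖y₀‖ r₁).trans (le_max_right M (max ‖y₀‖ r₁)); linarith
  have hR0 : 0 ≤ R := hr₁.trans hrR
  -- Clamping each coordinate makes the field globally bounded and Lipschitz without changing it on
  -- the sup-norm ball of radius `R`.
  set cl : ℝ → ℝ := fun x => max (-R) (min R x)
  have hcl : LipschitzWith 1 cl := by
    simpa using (LipschitzWith.id.const_min R).const_max (-R)
  have hclR : ∀ x, |cl x| ≤ R := fun x =>
    abs_le.2 ⟨le_max_left _ _, max_le (by linarith) (min_le_left _ _)⟩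
  have hclid : ∀ x, |x| ≤ R → cl x = x := fun x hx => by
    simp only [cl]
    rw [min_eq_right (abs_le.1 hx).2, max_eq_right (abs_le.1 hx).1]
  set π : ℝ × ℝ × ℝ → ℝ × ℝ × ℝ := fun y => (cl y.1, cl y.2.1, cl y.2.2)
  have hπ : LipschitzWith 1 π := by
    refine LipschitzWith.of_dist_le_mul fun y y' => ?_
    have h := fun a b => hcl.dist_le_mul a b
    simp only [NNReal.coe_one, one_mul] at h ⊢
    exact max_le_max (h _ _) (max_le_max (h _ _) (h _ _))
  have hπR : ∀ y, π y ∈ Metric.closedBall 0 R := fun y => by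
    rw [mem_closedBall_zero_iff]
    exact max_le (hclR _) (max_le (hclR _) (hclR _))
  have hπid : ∀ y, ‖y‖ ≤ R → π y = y := fun y hy => by
    have h1 : ‖y.1‖ ≤ R := (norm_fst_le y).trans hy
    have h2 : ‖y.2‖ ≤ R := (norm_snd_le y).trans hy
    simp only [π]
    rw [hclid _ h1, hclid _ ((norm_fst_le y.2).trans h2), hclid _ ((norm_snd_le y.2).trans h2)]
  have hγR : ∀ t, |γ (max t₀ t)| ≤ R := fun t => (hγr _ (le_max_left _ _)).trans hrR
  obtain ⟨KL, hKL⟩ := hp.exists_lipschitzOnWith_reducedField σ R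
  obtain ⟨Bd, hBd⟩ := hp.exists_norm_reducedField_le σ R
  obtain ⟨y, hy0, hy⟩ := exists_forall_hasDerivAt_of_lipschitzWith (K := KL * 1) (B := Bd)
    (f := fun t y => p.reducedField σ (γ (max t₀ t)) (π y))
    (fun t => by
      have := (hKL _ (hγR t)).comp (hπ.lipschitzOnWith (s := univ)) (fun y _ => hπR y)
      exact lipschitzOnWith_univ.1 this)
    (fun y => (hp.contDiff_reducedField σ).continuous.comp
      (g := fun u : ℝ × ℝ × ℝ × ℝ => p.reducedField σ u.1 u.2)
      (f := fun t => (γ (max t₀ t), π y)) (by fun_prop))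
    (fun t y => hBd _ (hγR t) _ (hπR y)) t₀ y₀
  have hsol : ∀ b, (∀ u ∈ Icc t₀ b, ‖y u‖ ≤ R) → p.IsReducedSolution σ γ y t₀ b := by
    intro b hb t ht
    have := hy t
    rw [max_eq_right ht.1, hπid _ (hb t ht)] at this
    exact this.hasDerivWithinAt
  refine ⟨y, hy0, fun b => hsol b fun u hu => le_of_lt ?_⟩
  have hcont : Continuous y := continuous_iff_continuousAt.2 fun t => (hy t).continuousAt
  -- While it stays within `R` the curve solves the true system, so it obeys the bound `M < R` and
  -- never feels the clamping.
  exact lt_of_forall_le_imp_lt (N := fun t => ‖y t‖) hcont.norm.continuousOn (by rw [hy0]; exact hyR)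
    (fun t ht h => (hM t y ht.1 hy0 (hsol t h)).trans_lt hMR) u hu

theorem Admissible.tendsto_isReducedSolution (hp : p.Admissible) {σ t₀ : ℝ} {γ : ℝ → ℝ}
    {y : ℝ → ℝ × ℝ × ℝ}
    (hγ : ∀ t, t₀ ≤ t → |γ t| ≤ |γ t₀| * Real.exp (-p.a * (t - t₀)))
    (hy : ∀ b, p.IsReducedSolution σ γ y t₀ b) : Tendsto y atTop (𝓝 0) := by
  obtain ⟨μ, k, K, hμ, hk, hK, hbd⟩ := hp.exists_bounds σ
  have hn : 0 ≤ 2 * p.d₃ := by linarith [hp.d₃_pos]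
  have hw := hp.weight_pos
  set r := max |γ t₀| |(y t₀).1|
  have hr : 0 ≤ r := (abs_nonneg _).trans (le_max_left _ _)
  have hb := fun t (ht : t₀ ≤ t) => hbd r t₀ t γ y hr
    (fun u hu => (hγ u hu.1).trans (by gcongr; exact le_max_left _ _)) (le_max_right _ _) (hy t) t
    (right_mem_Icc.2 ht)
  set B := pendulumEnergy (2 * p.d₃) p.weight (y t₀).2.1 (y t₀).2.2 * Real.exp (K * (r * (1 + r)))
  have hB := fun t (ht : t₀ ≤ t) => abs_le_of_pendulumEnergy_le hn hw (hb t ht).2.2.2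
  obtain ⟨h1, h2⟩ := tendsto_zero_of_perturbed_pendulum (t₀ := t₀)
    (R := max √(2 * (B - p.weight) / p.weight) √(2 * (B - p.weight))) (k := k * r)
    hp.d₁_pos hp.d₂_pos hp.d₃_pos hμ
    (fun b t ht => (hy b).hasDerivWithinAt_snd_fst ht)
    (fun b t ht => (hy b).hasDerivWithinAt_snd_snd ht)
    (fun t ht => (hB t ht).1.trans (le_max_left _ _))
    (fun t ht => (hB t ht).2.trans (le_max_right _ _))
    (fun t ht => (hb t ht).2.1) (fun t ht => (hb t ht).2.2.1)
  have h0 : Tendsto (fun t => (y t).1) atTop (𝓝 0) := by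
    have h3 : Tendsto (fun t : ℝ => μ * (t - t₀)) atTop atTop :=
      (tendsto_atTop_add_const_right _ (-t₀) tendsto_id).const_mul_atTop hμ
    have h4 := (Real.tendsto_exp_neg_atTop_nhds_zero.comp h3).const_mul (k * r)
    rw [mul_zero] at h4
    refine squeeze_zero_norm' ?_ h4
    filter_upwards [eventually_ge_atTop t₀] with t ht
    simpa using (hb t ht).1
  exact h0.prodMk_nhds (h1.prodMk_nhds h2)

end CartPendulum

/-! ### Passage between the original and the reduced coordinates. -/

theorem AbsolutelyContinuousOnInterval.prodMk {X Y : Type*} [PseudoMetricSpace X]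
    [PseudoMetricSpace Y] {f : ℝ → X} {g : ℝ → Y} {a b : ℝ}
    (hf : AbsolutelyContinuousOnInterval f a b) (hg : AbsolutelyContinuousOnInterval g a b) :
    AbsolutelyContinuousOnInterval (fun t => (f t, g t)) a b := by
  refine squeeze_zero (fun E => Finset.sum_nonneg fun i _ => dist_nonneg) (fun E => ?_)
    (by simpa using Tendsto.add hf hg)
  rw [← Finset.sum_add_distrib]
  exact Finset.sum_le_sum fun i _ => max_le_add_of_nonneg dist_nonneg dist_nonneg

theorem AbsolutelyContinuousOnInterval.of_hasDerivWithinAt {E : Type*} [NormedAddCommGroup E]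
    [NormedSpace ℝ E] {f f' : ℝ → E} {a b : ℝ} (hab : a ≤ b)
    (hf : ∀ t ∈ Icc a b, HasDerivWithinAt f (f' t) (Icc a b) t)
    (hc : ContinuousOn f' (Icc a b)) : AbsolutelyContinuousOnInterval f a b := by
  obtain ⟨C, hC⟩ := isCompact_Icc.exists_bound_of_continuousOn hc
  refine LipschitzOnWith.absolutelyContinuousOnInterval (K := C.toNNReal) ?_
  rw [uIcc_of_le hab]
  refine (convex_Icc a b).lipschitzOnWith_of_nnnorm_hasDerivWithin_le hf fun t ht => ?_
  rw [← NNReal.coe_le_coe, coe_nnnorm]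
  exact (hC t ht).trans (Real.le_coe_toNNReal C)

theorem hasDerivAt_apply_of_euclidean {n : ℕ} {x : ℝ → EuclideanSpace ℝ (Fin n)}
    {v : EuclideanSpace ℝ (Fin n)} {t : ℝ} (h : HasDerivAt x v t) (i : Fin n) :
    HasDerivAt (fun t => x t i) (v i) t :=
  (EuclideanSpace.proj (𝕜 := ℝ) i).hasFDerivAt.comp_hasDerivAt t h

theorem hasDerivAt_euclidean_of_apply {n : ℕ} {x : ℝ → EuclideanSpace ℝ (Fin n)}
    {v : EuclideanSpace ℝ (Fin n)} {t : ℝ} (h : ∀ i, HasDerivAt (fun t => x t i) (v i) t) :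
    HasDerivAt x v t :=
  HasFDerivAt.comp_hasDerivAt (f := fun t => (x t).ofLp) t
    (PiLp.hasFDerivAt_toLp (𝕜 := ℝ) 2 (x t).ofLp) (hasDerivAt_pi.2 h)

namespace CartPendulum

variable {p : CartPendulum}

/-- The reduced coordinates `(s, Ω, z)` of a state. -/
noncomputable def toReduced (p : CartPendulum) (x : EuclideanSpace ℝ (Fin 4)) : ℝ × ℝ × ℝ :=
  (x 0, x 2, x 3 - p.coupling * (x 1 / p.psi (angle (x 2))))

/-- The state with given `(γ, (s, Ω, z))`. -/
noncomputable def ofReduced (p : CartPendulum) (u : ℝ × ℝ × ℝ × ℝ) : EuclideanSpace ℝ (Fin 4) :=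
  !₂[u.2.1, u.1, u.2.2.1, u.2.2.2 + p.coupling * (u.1 / p.psi (angle u.2.2.1))]

theorem ofReduced_toReduced (x : EuclideanSpace ℝ (Fin 4)) :
    p.ofReduced (x 1, p.toReduced x) = x := by
  ext i
  fin_cases i <;> simp [ofReduced, toReduced]

theorem ofReduced_apply_one (u : ℝ × ℝ × ℝ × ℝ) : p.ofReduced u 1 = u.1 := by
  simp [ofReduced]

theorem ofReduced_zero : p.ofReduced 0 = 0 := by
  ext i
  fin_cases i <;> simp [ofReduced]

theorem hasDerivAt_psi_angle {Ω : ℝ → ℝ} {ω t : ℝ} (h : HasDerivAt Ω ω t) :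
    HasDerivAt (fun t => p.psi (angle (Ω t))) (p.psiDot (angle (Ω t)) ω) t := by
  simp_rw [psi_angle]
  have hC := Real.cosh_pos (Ω t)
  refine (((hasDerivAt_const t (p.L ^ 2)).div (h.cosh.pow 2) (pow_pos hC 2).ne').const_sub
    (p.M * p.I)).congr_deriv ?_
  rw [psiDot, Real.sin_two_mul, sin_angle, cos_angle]
  simp only [Pi.pow_apply]
  field_simp
  ring

/-- Because `A = B G`, the assumed lower bound on the relay amplitude is exactly domination of the
disturbance. -/
theorem abs_disturbance_le {U Dmax : ℝ} (hG : 0 < p.G) (hU : Dmax ≤ p.G * U) {d : ℝ} (hd : |d| ≤ Dmax) :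
    |p.B * d| ≤ p.A * U := by
  have hA : 0 ≤ p.A := abs_nonneg _
  have hB : p.B * p.G = p.A := div_mul_cancel₀ _ hG.ne'
  have hB0 : 0 ≤ p.B := div_nonneg hA hG.le
  rw [abs_mul, abs_of_nonneg hB0, ← hB, mul_assoc]
  exact mul_le_mul_of_nonneg_left (hd.trans hU) hB0

namespace Admissible

variable (hp : p.Admissible)
include hp

theorem contDiff_toReduced : ContDiff ℝ 1 p.toReduced := by
  have hψ : ContDiff ℝ 1 fun x : EuclideanSpace ℝ (Fin 4) => x 1 / p.psi (angle (x 2)) :=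
    ContDiff.div (by fun_prop)
      (contDiff_psi_angle.comp (g := fun Ω => p.psi (angle Ω)) (by fun_prop))
      fun x => (hp.psi_pos _).ne'
  unfold toReduced
  fun_prop

theorem contDiff_ofReduced : ContDiff ℝ 1 p.ofReduced := by
  have hψ : ContDiff ℝ 1 fun u : ℝ × ℝ × ℝ × ℝ => u.1 / p.psi (angle u.2.2.1) :=
    contDiff_fst.div (contDiff_psi_angle.comp (g := fun Ω => p.psi (angle Ω)) (by fun_prop))
      fun u => (hp.psi_pos _).ne'
  refine contDiff_euclidean.2 fun i => ?_
  fin_cases i <;> simp only [ofReduced] <;> simp <;> fun_prop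

/-- The derivative of the subtracted term `coupling * γ / ψ` cancels all occurrences of `w` and `d`,
whatever their values. -/
theorem hasDerivAt_toReduced {σ w d t : ℝ} {x : ℝ → EuclideanSpace ℝ (Fin 4)}
    (h : HasDerivAt x (p.rhs σ w d (x t)) t) :
    HasDerivAt (fun t => p.toReduced (x t)) (p.reducedField σ (x t 1) (p.toReduced (x t))) t := by
  have h0 := hasDerivAt_apply_of_euclidean h 0
  have h1 := hasDerivAt_apply_of_euclidean h 1
  have h2 := hasDerivAt_apply_of_euclidean h 2
  have h3 := hasDerivAt_apply_of_euclidean h 3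
  simp only [rhs] at h0 h1 h2 h3
  simp at h0 h1 h2 h3
  have hq := (h1.div (hasDerivAt_psi_angle h2) (hp.psi_pos _).ne').const_mul p.coupling
  refine (h0.prodMk (h2.prodMk (h3.sub hq))).congr_deriv ?_
  simp only [reducedField, toReduced, pendulumForce, tan_angle, sin_angle, coupling,
    sub_add_cancel]
  refine Prod.ext (by ring) (Prod.ext (by ring) ?_)
  simp only
  ring

theorem hasDerivAt_ofReduced {σ w d t : ℝ} {γ : ℝ → ℝ} {y : ℝ → ℝ × ℝ × ℝ}
    (hγ : HasDerivAt γ (-p.a * γ t - p.A * w - p.B * d) t)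
    (hy : HasDerivAt y (p.reducedField σ (γ t) (y t)) t) :
    HasDerivAt (fun t => p.ofReduced (γ t, y t)) (p.rhs σ w d (p.ofReduced (γ t, y t))) t := by
  have h0 : HasDerivAt (fun t => (y t).1) (p.reducedField σ (γ t) (y t)).1 t :=
    (ContinuousLinearMap.fst ℝ ℝ (ℝ × ℝ)).hasFDerivAt.comp_hasDerivAt t hy
  have h2 : HasDerivAt (fun t => (y t).2.1) (p.reducedField σ (γ t) (y t)).2.1 t :=
    ((ContinuousLinearMap.fst ℝ ℝ ℝ).comp
      (ContinuousLinearMap.snd ℝ ℝ (ℝ × ℝ))).hasFDerivAt.comp_hasDerivAt t hy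
  have h3 : HasDerivAt (fun t => (y t).2.2) (p.reducedField σ (γ t) (y t)).2.2 t :=
    ((ContinuousLinearMap.snd ℝ ℝ ℝ).comp
      (ContinuousLinearMap.snd ℝ ℝ (ℝ × ℝ))).hasFDerivAt.comp_hasDerivAt t hy
  have hq := (hγ.div (hasDerivAt_psi_angle h2) (hp.psi_pos _).ne').const_mul p.coupling
  refine hasDerivAt_euclidean_of_apply fun i => ?_
  fin_cases i
  · simpa [ofReduced, rhs, reducedField] using h0
  · simpa [ofReduced, rhs] using hγ
  · simpa [ofReduced, rhs, reducedField] using h2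
  · have h := h3.add hq
    simp only [reducedField, pendulumForce] at h
    simp [ofReduced, rhs, tan_angle, sin_angle]
    refine h.congr_deriv ?_
    simp only [coupling]
    ring

/-! ### The closed loop: existence, uniqueness, attraction and stability. -/

variable {σ U Dmax : ℝ} {D : ℝ → ℝ}

/-- The relay equation holds only almost everywhere, but the reduced field is continuous along the
motion, so the reduced equation holds at every time. -/
theorem relaySystem_coordinates {x : ℝ → EuclideanSpace ℝ (Fin 4)} {I : Set ℝ} {t₀ b : ℝ}
    (hx : IsSolutionOn (p.relaySystem σ U D) x I) (hb : t₀ ≤ b) (hI : Icc t₀ b ⊆ I) :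
    AbsolutelyContinuousOnInterval (fun t => x t 1) t₀ b ∧
    (∀ᵐ t : ℝ, t ∈ Icc t₀ b → ∃ ξ ∈ relaySign (x t 1),
      HasDerivAt (fun t => x t 1) (-p.a * x t 1 - p.A * U * ξ - p.B * D t) t) ∧
    p.IsReducedSolution σ (fun t => x t 1) (fun t => p.toReduced (x t)) t₀ b := by
  have hac := hx.1 t₀ b hb hI
  have h1 : AbsolutelyContinuousOnInterval (fun t => x t 1) t₀ b :=
    hac.contDiff_comp (g := fun x : EuclideanSpace ℝ (Fin 4) => x 1) (by fun_prop)
  have h2 := hac.contDiff_comp hp.contDiff_toReduced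
  refine ⟨h1, ?_, h2.hasDerivWithinAt_of_ae hb ?_ ?_⟩
  · filter_upwards [hx.2] with t ht htm
    obtain ⟨v, ⟨ξ, hξ, rfl⟩, hv⟩ := ht (hI htm)
    refine ⟨ξ, hξ, (hasDerivAt_apply_of_euclidean hv 1).congr_deriv ?_⟩
    simp [rhs]
    ring
  · have h3 := (h1.continuousOn).prodMk h2.continuousOn
    rw [uIcc_of_le hb] at h3
    exact (hp.contDiff_reducedField σ).continuous.comp_continuousOn h3
  · filter_upwards [hx.2] with t ht htm
    obtain ⟨v, ⟨ξ, hξ, rfl⟩, hv⟩ := ht (hI htm)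
    exact hp.hasDerivAt_toReduced hv

theorem exists_relaySystem_solution (hG : 0 < p.G) (hU : Dmax ≤ p.G * U)
    (hDc : ContinuousOn D (Ici 0)) (hDb : ∀ t : ℝ, 0 ≤ t → |D t| ≤ Dmax) {t₀ : ℝ} (ht₀ : 0 ≤ t₀)
    (x₀ : EuclideanSpace ℝ (Fin 4)) :
    ∃ x : ℝ → EuclideanSpace ℝ (Fin 4), x t₀ = x₀ ∧
      IsSolutionOn (p.relaySystem σ U D) x (Ici t₀) := by
  -- `D` is frozen at `D 0` for negative times, where nothing is assumed about it.
  have hDc' : Continuous fun t => p.B * D (max 0 t) :=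
    continuous_const.mul (hDc.comp_continuous (by fun_prop) fun t => mem_Ici.2 (le_max_left _ _))
  obtain ⟨γ, hγc, hγ0, hγac, hγd⟩ := exists_relay_solution (a := p.a) (κ := p.A * U) (t₀ := t₀)
    (γ₀ := x₀ 1) hDc' fun t => abs_disturbance_le hG hU (hDb _ (le_max_left _ _))
  have hγb : ∀ t, t₀ ≤ t → |γ t| ≤ |x₀ 1| * Real.exp (-p.a * (t - t₀)) := by
    intro t ht
    rw [← hγ0]
    refine abs_le_mul_exp_of_relay ht (hγac _ _)
      (fun u hu => abs_disturbance_le hG hU (hDb _ (le_max_left 0 u))) ?_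
    filter_upwards [hγd] with u hu _ using hu
  obtain ⟨y, hy0, hy⟩ := hp.exists_isReducedSolution σ hγc (abs_nonneg _) hγb (p.toReduced x₀)
  refine ⟨fun t => p.ofReduced (γ t, y t), ?_, fun t₁ t₂ h12 hsub => ?_, ?_⟩
  · simp only [hγ0, hy0, ofReduced_toReduced]
  · have hm : Icc t₁ t₂ ⊆ Icc t₀ t₂ := Icc_subset_Icc_left (hsub (left_mem_Icc.2 h12))
    have h1 : AbsolutelyContinuousOnInterval y t₁ t₂ :=
      .of_hasDerivWithinAt h12 (fun t ht => (hy t₂ t (hm ht)).mono hm)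
        ((hp.contDiff_reducedField σ).continuous.comp_continuousOn
          (hγc.continuousOn.prodMk ((hy t₂).continuousOn.mono hm)))
    exact ((hγac t₁ t₂).prodMk h1).contDiff_comp hp.contDiff_ofReduced
  -- At `t₀` the reduced solution has only a one-sided derivative; this single point is null.
  · filter_upwards [hγd, Measure.ae_ne volume t₀] with t ⟨ξ, hξ, hd⟩ hne ht
    have ht' : t₀ < t := lt_of_le_of_ne ht hne.symm
    rw [max_eq_right (ht₀.trans ht)] at hd
    refine ⟨_, ⟨ξ, by rwa [ofReduced_apply_one], rfl⟩, hp.hasDerivAt_ofReduced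
      (hd.congr_deriv (by ring)) ?_⟩
    exact (hy (t + 1) t ⟨ht, by linarith⟩).hasDerivAt (Icc_mem_nhds ht' (by linarith))

/-- Monotonicity of the relay determines `γ`; both reduced curves are then driven by the same
signal, and the Lipschitz property applies. -/
theorem relaySystem_unique (hU : 0 ≤ U) {x₁ x₂ : ℝ → EuclideanSpace ℝ (Fin 4)} {I₁ I₂ : Set ℝ}
    {t₀ b : ℝ} (hx₁ : IsSolutionOn (p.relaySystem σ U D) x₁ I₁)
    (hx₂ : IsSolutionOn (p.relaySystem σ U D) x₂ I₂) (hb : t₀ ≤ b) (hI₁ : Icc t₀ b ⊆ I₁)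
    (hI₂ : Icc t₀ b ⊆ I₂) (h0 : x₁ t₀ = x₂ t₀) : x₁ b = x₂ b := by
  have hγ : EqOn (fun t => x₁ t 1) (fun t => x₂ t 1) (Icc t₀ b) := by
    intro t ht
    have hs : Icc t₀ t ⊆ Icc t₀ b := Icc_subset_Icc_right ht.2
    obtain ⟨h1, h2, -⟩ := hp.relaySystem_coordinates hx₁ ht.1 (hs.trans hI₁)
    obtain ⟨h3, h4, -⟩ := hp.relaySystem_coordinates hx₂ ht.1 (hs.trans hI₂)
    exact relay_unique hp.a_pos.le (mul_nonneg (abs_nonneg _) hU) ht.1 h1 h3 h2 h4 (by simp [h0])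
  obtain ⟨h1, -, h2⟩ := hp.relaySystem_coordinates hx₁ hb hI₁
  obtain ⟨-, -, h3⟩ := hp.relaySystem_coordinates hx₂ hb hI₂
  have hc := h1.continuousOn
  rw [uIcc_of_le hb] at hc
  have h3' : p.IsReducedSolution σ (fun t => x₁ t 1) (fun t => p.toReduced (x₂ t)) t₀ b :=
    fun t ht => by
      have := h3 t ht
      rwa [← hγ ht] at this
  have hy := hp.isReducedSolution_unique hc h2 h3' (by simp [h0]) (right_mem_Icc.2 hb)
  rw [← ofReduced_toReduced (p := p) (x₁ b), ← ofReduced_toReduced (p := p) (x₂ b)]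
  exact congrArg p.ofReduced (Prod.ext (hγ (right_mem_Icc.2 hb)) hy)

theorem relaySystem_decay (hG : 0 < p.G) (hU : Dmax ≤ p.G * U)
    (hDb : ∀ t : ℝ, 0 ≤ t → |D t| ≤ Dmax) {t₀ : ℝ} (ht₀ : 0 ≤ t₀)
    {x : ℝ → EuclideanSpace ℝ (Fin 4)}
    (hx : IsSolutionOn (p.relaySystem σ U D) x (Ici t₀)) {t : ℝ} (ht : t₀ ≤ t) :
    |x t 1| ≤ |x t₀ 1| * Real.exp (-p.a * (t - t₀)) := by
  obtain ⟨h1, h2, -⟩ := hp.relaySystem_coordinates hx ht Icc_subset_Ici_self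
  exact abs_le_mul_exp_of_relay ht h1
    (fun u hu => abs_disturbance_le hG hU (hDb u (ht₀.trans hu.1))) h2

theorem relaySystem_attractive (hG : 0 < p.G) (hU : Dmax ≤ p.G * U)
    (hDb : ∀ t : ℝ, 0 ≤ t → |D t| ≤ Dmax) {t₀ : ℝ} (ht₀ : 0 ≤ t₀)
    {x : ℝ → EuclideanSpace ℝ (Fin 4)}
    (hx : IsSolutionOn (p.relaySystem σ U D) x (Ici t₀)) : Tendsto x atTop (𝓝 0) := by
  have hγ := fun t (ht : t₀ ≤ t) => hp.relaySystem_decay hG hU hDb ht₀ hx ht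
  have hy : Tendsto (fun t => p.toReduced (x t)) atTop (𝓝 0) := by
    refine hp.tendsto_isReducedSolution (σ := σ) (γ := fun t => x t 1) hγ fun b => ?_
    rcases le_total t₀ b with hb | hb
    · exact (hp.relaySystem_coordinates hx hb Icc_subset_Ici_self).2.2
    · exact (hp.relaySystem_coordinates hx le_rfl Icc_subset_Ici_self).2.2.mono hb
  have hγ0 : Tendsto (fun t => x t 1) atTop (𝓝 0) := by
    have h3 : Tendsto (fun t : ℝ => p.a * (t - t₀)) atTop atTop :=
      (tendsto_atTop_add_const_right _ (-t₀) tendsto_id).const_mul_atTop hp.a_pos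
    have h4 := (Real.tendsto_exp_neg_atTop_nhds_zero.comp h3).const_mul |x t₀ 1|
    rw [mul_zero] at h4
    refine squeeze_zero_norm' ?_ h4
    filter_upwards [eventually_ge_atTop t₀] with t ht
    simpa using hγ t ht
  have h := (hp.contDiff_ofReduced.continuous.tendsto 0).comp (hγ0.prodMk_nhds hy)
  rw [ofReduced_zero] at h
  refine h.congr fun t => ?_
  exact ofReduced_toReduced (x t)

theorem relaySystem_stable (hG : 0 < p.G) (hU : Dmax ≤ p.G * U)
    (hDb : ∀ t : ℝ, 0 ≤ t → |D t| ≤ Dmax) {ε : ℝ} (hε : 0 < ε) :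
    ∃ δ : ℝ, 0 < δ ∧ ∀ t₀ : ℝ, 0 ≤ t₀ → ∀ x : ℝ → EuclideanSpace ℝ (Fin 4),
      IsSolutionOn (p.relaySystem σ U D) x (Ici t₀) → ‖x t₀‖ < δ → ∀ t : ℝ, t₀ ≤ t → ‖x t‖ < ε := by
  obtain ⟨η, hη, hηε⟩ := Metric.continuousAt_iff.1
    (hp.contDiff_ofReduced.continuous.continuousAt (x := 0)) ε hε
  obtain ⟨μ, k, K, hμ, hk, hK, hbd⟩ := hp.exists_bounds σ
  have hn : 0 ≤ 2 * p.d₃ := by linarith [hp.d₃_pos]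
  have hw := hp.weight_pos
  have hg : 0 < p.M * p.I - p.L ^ 2 := sub_pos.2 hp.L_sq_lt
  set w := p.weight
  -- `c * r` bounds the initial `z`, which is `Ω'` minus `coupling * γ / ψ`.
  set c := 1 + p.coupling / (p.M * p.I - p.L ^ 2)
  set B : ℝ → ℝ := fun r => pendulumEnergy (2 * p.d₃) w r (c * r) * Real.exp (K * (r * (1 + r)))
  set Ψ : ℝ → ℝ := fun r => r + k * r + √(2 * (B r - w) / w) + √(2 * (B r - w))
  have hBc : Continuous B := by
    have h1 : ∀ q : ℝ, Continuous fun r : ℝ => Real.cosh r ^ q := fun q =>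
      Real.continuous_cosh.rpow_const fun r => Or.inl (Real.cosh_pos r).ne'
    have h2 := h1 (2 * p.d₃)
    have h3 := h1 (2 * p.d₃ + 1)
    unfold B pendulumEnergy
    fun_prop
  have hΨc : Continuous Ψ := by fun_prop
  -- At `r = 0` the energy bound is its minimum `w`, so the square roots vanish. As `Ψ` does not
  -- involve `t₀`, the resulting `δ` is uniform.
  have hΨ0 : Ψ 0 = 0 := by simp [Ψ, B, pendulumEnergy]
  obtain ⟨δ, hδ, hδη⟩ := Metric.continuousAt_iff.1 (hΨc.continuousAt (x := 0)) η hη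
  rw [hΨ0] at hδη
  set r := δ / 2
  have hr : 0 < r := by positivity
  have hΨη : Ψ r < η := by
    have := @hδη r (by rw [Real.dist_eq, sub_zero, abs_of_pos hr]; exact half_lt_self hδ)
    rw [Real.dist_eq, sub_zero] at this
    exact (le_abs_self _).trans_lt this
  refine ⟨r, hr, fun t₀ ht₀ x hx hxr t ht => ?_⟩
  have hxi : ∀ i, |x t₀ i| ≤ r := fun i => (PiLp.norm_apply_le (x t₀) i).trans hxr.le
  have hγ := fun u (hu : t₀ ≤ u) => hp.relaySystem_decay hG hU hDb ht₀ hx hu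
  obtain ⟨h1, -, -, h2⟩ := hbd r t₀ t (fun t => x t 1) (fun t => p.toReduced (x t)) hr.le
    (fun u hu => (hγ u hu.1).trans (by gcongr; exact hxi 1)) (hxi 0)
    (hp.relaySystem_coordinates hx ht Icc_subset_Ici_self).2.2 t (right_mem_Icc.2 ht)
  have hz₀ : |(p.toReduced (x t₀)).2.2| ≤ c * r := by
    refine (abs_sub _ _).trans ?_
    have h3 := hp.abs_div_psi_le (x t₀ 1) (angle (x t₀ 2))
    rw [abs_mul, abs_of_pos hp.coupling_pos]
    calc _ ≤ r + p.coupling * (r / (p.M * p.I - p.L ^ 2)) := by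
          have := hp.coupling_pos
          gcongr
          · exact hxi 3
          · exact h3.trans (by gcongr; exact hxi 1)
      _ = c * r := by ring
  have hE : pendulumEnergy (2 * p.d₃) w (p.toReduced (x t)).2.1 (p.toReduced (x t)).2.2 ≤ B r :=
    h2.trans (mul_le_mul_of_nonneg_right (pendulumEnergy_le hn hw (hxi 2) hz₀) (Real.exp_pos _).le)
  obtain ⟨h4, h5⟩ := abs_le_of_pendulumEnergy_le hn hw hE
  have hs1 := Real.sqrt_nonneg (2 * (B r - w) / w)
  have hs2 := Real.sqrt_nonneg (2 * (B r - w))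
  have hkr : 0 ≤ k * r := by positivity
  have hexp : ∀ q : ℝ, 0 < q → Real.exp (-q * (t - t₀)) ≤ 1 := fun q hq =>
    Real.exp_le_one_iff.2 (by nlinarith)
  have h6 : |x t 1| ≤ Ψ r := by
    have := (hγ t ht).trans (mul_le_of_le_one_right (abs_nonneg _) (hexp _ hp.a_pos))
    have := hxi 1
    simp only [Ψ]
    linarith
  have h7 : |(p.toReduced (x t)).1| ≤ Ψ r := by
    have := h1.trans (mul_le_of_le_one_right hkr (hexp _ hμ))
    simp only [Ψ]
    linarith
  have h8 : |(p.toReduced (x t)).2.1| ≤ Ψ r := by simp only [Ψ]; linarith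
  have h9 : |(p.toReduced (x t)).2.2| ≤ Ψ r := by simp only [Ψ]; linarith
  have h10 := @hηε (x t 1, p.toReduced (x t)) (by
    rw [dist_zero_right]
    exact (max_le h6 (max_le h7 (max_le h8 h9))).trans_lt hΨη)
  rwa [ofReduced_toReduced, ofReduced_zero, dist_zero_right] at h10

end Admissible

end CartPendulum

/-! ### Global asymptotic stability. -/

theorem mainTheorem2 (p : CartPendulum)
    (hM : 0 < p.M) (hm : 0 < p.m) (hl : 0 < p.l) (hJ : 0 < p.J) (hκ : 0 < p.κ)
    (hg : 0 < p.g) (hG : 0 < p.G) (hρ : 0 < p.ρ) (ha : 0 < p.a) (hα : 0 < p.α)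
    (hψ : p.L ^ 2 < p.M * p.I) (hρL : p.I < p.ρ * p.L) (hd₁ : 0 < p.d₁)
    (σ : ℝ) (Dmax U : ℝ) (hU : Dmax ≤ p.G * U)
    (D : ℝ → ℝ) (hDc : ContinuousOn D (Set.Ici 0)) (hDb : ∀ t : ℝ, 0 ≤ t → |D t| ≤ Dmax) :
    IsGloballyAsymptoticallyStable (p.relaySystem σ U D) := by
  have hL : 0 < p.L := mul_pos hm hl
  have hI : 0 < p.I := add_pos hJ (mul_pos hm (pow_pos hl 2))
  have hρLI : 0 < p.ρ * p.L - p.I := sub_pos.2 hρL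
  have hp : p.Admissible :=
    ⟨hL, hψ, hρL, ha, hα, hd₁, div_pos (mul_pos hL hg) hρLI, div_pos hI hρLI⟩
  have hU0 : 0 ≤ U :=
    nonneg_of_mul_nonneg_right (((abs_nonneg _).trans (hDb 0 le_rfl)).trans hU) hG
  refine ⟨fun t₀ ht₀ x₀ => hp.exists_relaySystem_solution hG hU hDc hDb ht₀ x₀, ?_,
    fun ε hε => hp.relaySystem_stable hG hU hDb hε,
    fun t₀ ht₀ x hx => hp.relaySystem_attractive hG hU hDb ht₀ hx⟩
  intro t₀ T ht₀ hT x hx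
  -- The global solution from the same initial state extends `x`, by forward uniqueness on each
  -- `[t₀, t]` with `t < T`.
  obtain ⟨y, hy0, hy⟩ := hp.exists_relaySystem_solution (σ := σ) hG hU hDc hDb ht₀ (x t₀)
  refine ⟨y, fun t ht => ?_, hy⟩
  exact hp.relaySystem_unique hU0 hx hy ht.1 (fun u hu => ⟨hu.1, hu.2.trans_lt ht.2⟩)
    Icc_subset_Ici_self hy0.symm
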